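/- Let $\alpha>0$, let $\mathcal X\subseteq\mathbb R^d$ carry its Borel $\sigma$-algebra, let $\mu$ be a $\sigma$-finite measure on $\mathcal X$ that is finite on compact sets, and let $\mathcal P=(P_\theta)_{\theta\in\Theta}$, $\Theta\subseteq\mathbb R$, be a model of probability measures on $\mathcal X$ with $\mu$-densities $p_\theta\ge 0$. **Notions.** A model $(P_\theta)_{\theta\in\Theta}$ with $\sigma$-finite dominating measure $\mu$ is *differentiable in quadratic mean* (DQM) at $\theta$ with score $s_\theta$ if $\theta$ is an interior point of $\Theta$, $s_\theta$ is measurable, and $\int(\sqrt{p_{\theta+h}}-\sqrt{p_\theta}-\tfrac12 h s_\theta\sqrt{p_\theta})^2\,d\mu=o(h^2)$ as $h\to0$; its Fisher information is then $I_\theta(\mathcal P)=\int s_\theta^2\,dP_\theta$. For a Markov kernel $Q$, $Q\mathcal P$ is the model $(QP_\theta)_{\theta\in\Theta}$, $QP_\theta(A)=\int Q(A|x)\,P_\theta(dx)$, and for a measurable map $T$, $T\mathcal P=(P_\theta T^{-1})_{\theta\in\Theta}$. $\mathcal Q_\alpha(\mathcal X)$ is the class of all Markov kernels $Q$ from $\mathcal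 X$ to arbitrary measurable spaces with $Q(A|x)\le e^\alpha Q(A|x')$ for all measurable $A$ and all $x,x'$. $\mathcal M_\alpha(k)$ is the set of column-stochastic $k\times k$ matrices $M$ with $e^{-\alpha}M_{ij'}\le M_{ij}\le e^{\alpha}M_{ij'}$ for all $i,j,j'$; such a matrix is identified with the Markov kernel on $\{1,\dots,k\}$ with $Q(\{i\}|j)=M_{ij}$. A *discretization at $\theta$ with error level $\varepsilon>0$* is a measurable map $T:\mathcal X\to\{1,\dots,k\}$, $k\in\mathbb N$, with cells $B_j=T^{-1}(\{j\})$, such that for every $Q\in\mathcal Q_\alpha(\mathcal X)$ and every $x_0\in\mathcal X$ the kernel $Q_\varepsilon(A|j)=\mu(B_j)^{-1}\int_{B_j}Q(A|x)\,\mu(dx)$ if $0<\mu(B_j)<\infty$, $Q_\varepsilon(A|j)=Q(A|x_0)$ otherwise, is an $\alpha$-private Markov kernel (that is, $Q_\varepsilon(A|j)\le e^\alpha Q_\varepsilon(A|j')$ for all measurable $A$ and all $j,j'$) and satisfies $|I_\theta(Q_\varepsilon T\mathcal P)-I_\theta(Q\mathcal P)|\le\max(I_\theta(\mathcal P),1)\,\varepsilon$.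 **Theorem.** Suppose that $\mathcal P$ is DQM at every $\theta\in\Theta$ with score $s_\theta$, that $x\mapsto p_\theta(x)$ and $x\mapsto s_\theta(x)p_\theta(x)$ are continuous on $\mathcal X$ for every $\theta\in\Theta$, that $\theta\mapsto s_\theta p_\theta$ is continuous from $\Theta$ to $L_1(\mu)$, and that $\theta\mapsto I_\theta(\mathcal P)$ is continuous on $\Theta$. Let $\hat\theta_n:\Omega\to\Theta$ be random variables on a probability space $(\Omega,\mathcal A,P)$ converging in $P$-probability to some $\theta_0\in\Theta$, and let $\varepsilon_n>0$ with $\varepsilon_n\to0$. Then: 1. for every $\varepsilon>0$ and $\theta\in\Theta$ there is a discretization at $\theta$ with error level $\varepsilon$; 2. $\sup_{Q\in\mathcal Q_\alpha(\mathcal X)}I_{\theta_0}(Q\mathcal P)<\infty$; 3. for any choice of discretizations $T_\varepsilon^{(\theta)}:\mathcal X\to\{1,\dots,k_\varepsilon^{(\theta)}\}$ at $\theta$ with error level $\varepsilon$ ($\varepsilon>0$, $\theta\in\Theta$), writing $\hat T_n=T_{\varepsilon_n}^{(\hat\theta_n)}$ and $\hat k_n=k_{\varepsilon_n}^{(\hat\theta_n)}$,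 every maximizer $\hat Q_n$ of $Q\mapsto I_{\hat\theta_n}(Q\hat T_n\mathcal P)$ over $\mathcal M_\alpha(\hat k_n)$ and every sequence $\theta_n\in\Theta$ with $\theta_n\to\theta_0$ satisfy $$I_{\theta_n}(\hat Q_n\hat T_n\mathcal P)\;\longrightarrow\;\sup_{Q\in\mathcal Q_\alpha(\mathcal X)}I_{\theta_0}(Q\mathcal P)\quad\text{in }P\text{-probability}$$ (in outer probability, should the left-hand side not be measurable in $\omega$). -/

import Mathlib

open MeasureTheory ProbabilityTheory Filter Topology

universe u

/-- The `μ`-density `p_t = dP_t / dμ` of a model `P`, as a real function. -/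
noncomputable def modelDensity {S : Type*} [MeasurableSpace S]
    (P : ℝ → Measure S) (μ : Measure S) (t : ℝ) (x : S) : ℝ :=
  ((P t).rnDeriv μ x).toReal

/-- Differentiability in quadratic mean at `θ` of the one-parameter model `(P t)_{t ∈ Θ}`, with
`σ`-finite dominating measure `μ` and score `s` at `θ`: the point `θ` is interior to `Θ` and
`∫ (√p_{θ+h} - √p_θ - (1/2) h s √p_θ)² dμ = o(h²)` as `h → 0`. The integral of this non-negative
function is taken in `[0, ∞]`. Only the measures `P t` with `t ∈ Θ` play a role. -/
structure IsDQMScore {S : Type*} [MeasurableSpace S] (Θ : Set ℝ) (P : ℝ → Measure S)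
    (μ : Measure S) (θ : ℝ) (s : S → ℝ) : Prop where
  sigmaFinite : SigmaFinite μ
  dominated : ∀ t ∈ Θ, P t ≪ μ
  mem_interior : θ ∈ interior Θ
  measurable_score : Measurable s
  isLittleO : Tendsto
    (fun h : ℝ =>
      (∫⁻ x, ENNReal.ofReal
        ((√(modelDensity P μ (θ + h) x) - √(modelDensity P μ θ x)
          - 1 / 2 * h * s x * √(modelDensity P μ θ x)) ^ 2) ∂μ) / ENNReal.ofReal (h ^ 2))
    (𝓝[≠] 0) (𝓝 0)

open Classical in
/-- The Fisher information `I_θ = E_θ[s_θ²]` of a model that is differentiable in quadratic mean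
at `θ`, with `s_θ` a score at `θ`. (Scores at `θ` agree `P θ`-almost everywhere, whatever the
dominating measure, so the choice is immaterial. The value is `0` if there is no score.) -/
noncomputable def fisherInfo {S : Type*} [MeasurableSpace S] (Θ : Set ℝ) (P : ℝ → Measure S)
    (θ : ℝ) : ℝ :=
  if H : ∃ s : S → ℝ, ∃ μ : Measure S, IsDQMScore Θ P μ θ s then
    ∫ x, (H.choose x) ^ 2 ∂(P θ)
  else 0

/-- The `α`-privacy constraint `Q(A | x) ≤ e^α Q(A | x')` on a kernel. -/
def IsPrivateKernel {S Z : Type*} [MeasurableSpace S] [MeasurableSpace Z] (α : ℝ)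
    (Q : Kernel S Z) : Prop :=
  ∀ A : Set Z, MeasurableSet A → ∀ x x' : S, Q x A ≤ ENNReal.ofReal (Real.exp α) * Q x' A

/-- The set of all values `I_θ(QP)`, where `Q` ranges over the `α`-private Markov kernels from
the sample space to an arbitrary measurable space (in an arbitrary universe). -/
def privateFisherInfos {S : Type*} [MeasurableSpace S] (α : ℝ) (Θ : Set ℝ) (P : ℝ → Measure S)
    (θ : ℝ) : Set ℝ :=
  {r | ∃ (Z : Type u) (_ : MeasurableSpace Z) (Q : Kernel S Z),
    IsMarkovKernel Q ∧ IsPrivateKernel α Q ∧ r = fisherInfo Θ (fun t => Q ∘ₘ P t) θ}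

/-- A finite measurable partition of `S`, given by its labelling map `T : S → Fin k`
(the cells are `T ⁻¹' {j}`). -/
structure Discretization (S : Type*) [MeasurableSpace S] where
  k : ℕ
  T : S → Fin k
  measurable_T : Measurable T

open Classical in
/-- The kernel from labels to points that sends `j` to the normalized restriction of `μ` to the
cell `B_j` if `0 < μ(B_j) < ∞`, and to the Dirac measure at `x₀` otherwise. -/
noncomputable def Discretization.cellKernel {S : Type*} [MeasurableSpace S]
    (D : Discretization S) (μ : Measure S) (x₀ : S) : Kernel (Fin D.k) S :=
  Kernel.ofFunOfCountable fun j =>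
    if 0 < μ (D.T ⁻¹' {j}) ∧ μ (D.T ⁻¹' {j}) < ⊤ then μ[|D.T ⁻¹' {j}] else Measure.dirac x₀

/-- The kernel `Q_ε` on labels obtained from `Q` by averaging over cells:
`Q_ε(A | j) = μ(B_j)⁻¹ ∫_{B_j} Q(A | x) μ(dx)` if `0 < μ(B_j) < ∞`, and `Q_ε(A | j) = Q(A | x₀)`
otherwise. In terms of densities `q(z | x)` with respect to `ν = Q(· | x₀)`, it has the
`ν`-densities `μ(B_j)⁻¹ ∫_{B_j} q(z | x) μ(dx)` and `1`, respectively. -/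
noncomputable def Discretization.avgKernel {S Z : Type*} [MeasurableSpace S] [MeasurableSpace Z]
    (D : Discretization S) (μ : Measure S) (x₀ : S) (Q : Kernel S Z) : Kernel (Fin D.k) Z :=
  Q ∘ₖ D.cellKernel μ x₀

/-- `D` is a discretization of the model at `θ` with error level `ε`: for every `α`-private
Markov kernel `Q` on the sample space, the cell-averaged kernel `Q_ε` is an `α`-private Markov
kernel and `|I_θ(Q_ε T P) - I_θ(QP)| ≤ max(I_θ(P), 1) ε`. -/
def Discretization.IsApprox {S : Type*} [MeasurableSpace S]
    (D : Discretization S) (α : ℝ) (Θ : Set ℝ) (P : ℝ → Measure S) (μ : Measure S)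
    (ε θ : ℝ) : Prop :=
  ∀ (Z : Type u) [MeasurableSpace Z] (Q : Kernel S Z), IsMarkovKernel Q → IsPrivateKernel α Q →
    ∀ x₀ : S,
      IsMarkovKernel (D.avgKernel μ x₀ Q) ∧ IsPrivateKernel α (D.avgKernel μ x₀ Q) ∧
      |fisherInfo Θ (fun t => D.avgKernel μ x₀ Q ∘ₘ (P t).map D.T) θ
          - fisherInfo Θ (fun t => Q ∘ₘ P t) θ|
        ≤ max (fisherInfo Θ P θ) 1 * ε

/-- The polytope `M_α(ℓ, k)` of column-stochastic `ℓ × k` matrices in which any two entries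
of a row differ by a factor of at most `e^α`. -/
def privateMatrices (α : ℝ) (l k : ℕ) : Set (Matrix (Fin l) (Fin k) ℝ) :=
  {M | (∀ i j, 0 ≤ M i j) ∧ (∀ j, ∑ i, M i j = 1) ∧
    ∀ i j j', Real.exp (-α) * M i j' ≤ M i j ∧ M i j ≤ Real.exp α * M i j'}

/-- The kernel `{1, …, k} → {1, …, ℓ}` with `Q({i} | j) = M i j`. -/
noncomputable def matrixKernel {l k : ℕ} (M : Matrix (Fin l) (Fin k) ℝ) :
    Kernel (Fin k) (Fin l) :=
  Kernel.ofFunOfCountable fun j => ∑ i, ENNReal.ofReal (M i j) • Measure.dirac i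

/-- `I_θ(Q T P)` for a discretization `T` and a matrix `Q`. -/
noncomputable def discreteFisherInfo {S : Type*} [MeasurableSpace S] (Θ : Set ℝ)
    (P : ℝ → Measure S) (D : Discretization S) {l : ℕ} (M : Matrix (Fin l) (Fin D.k) ℝ)
    (θ : ℝ) : ℝ :=
  fisherInfo Θ (fun t => matrixKernel M ∘ₘ (P t).map D.T) θ

/-!
# Private Fisher information of discretized models

Write `c = exp α`, let `Q` be an `α`-private kernel and `ν = Q x₀` one of its values. All measures
`Q x` lie between `c⁻¹ ν` and `c ν`, so for an integrable `f` the signed measure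
`A ↦ ∫ Q(A | x) f(x) μ(dx)` has a `ν`-density bounded by `c ‖f‖₁`. Thus a private kernel maps
`L¹(μ)` boundedly into `L^∞(ν)`, with a norm that does not depend on the kernel, and everything
reduces to `L¹`-estimates for `p_θ` and `s_θ p_θ`.

* Differentiability in quadratic mean makes `θ ↦ p_θ` differentiable in `L¹(μ)` with derivative
  `s_θ p_θ` (`IsDQMScore.eventually_integral_abs_le`). The densities `g_θ` of `QP_θ` are then
  differentiable in `L^∞(ν)` and bounded away from zero, so `QP` is differentiable in quadratic mean
  and `I_θ(QP) = ∫ G² / g_θ dν`, with `G` the density that belongs to `s_θ p_θ`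
  (`IsComparable.fisherInfo_comp`). Scores are unique up to null sets, whatever the dominating
  measure (`IsDQMScore.fisherInfo_eq`), so this is the value of `fisherInfo`.
* The formula is bounded and Lipschitz in `(s_θ p_θ, p_θ) ∈ L¹ × L¹`, uniformly in `Q`
  (`IsComparable.fisherInfo_le`, `IsComparable.abs_fisherInfo_sub_le`). Hence the supremum over `Q`
  is finite, and the functions `θ ↦ I_θ(QP)` are equicontinuous.
* Averaging `Q` over cells does not change its integral against functions that are constant on
  cells. The joint level sets of simple functions close to `p_θ` and `s_θ p_θ` therefore form a
  discretization (`IsDQMScore.exists_isApprox`).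
* For a channel with `k` inputs the information is an integral over `z` of a function of the vector
  of densities `(q(z | 1), …, q(z | k))`, which is homogeneous of degree one. Carathéodory's
  theorem and the removal of atoms along linear relations replace the distribution of this vector
  by one with `k` atoms, that is, by a `k × k` matrix with at least the same information
  (`exists_privateMatrix_fisherInfo_le`).

Consequently, a maximizing matrix at a parameter near `θ₀` competes with all averaged kernels, hence
with all private kernels up to the error level, and by equicontinuity its information at parameters
near `θ₀` is close to the supremum at `θ₀` (`exists_abs_discreteFisherInfo_sub_le`).
-/

/-! ### Scores and the choice of the dominating measure -/

/-- The remainder in the definition of differentiability in quadratic mean. -/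
noncomputable def dqmRemainder {S : Type*} [MeasurableSpace S] (P : ℝ → Measure S)
    (μ : Measure S) (θ : ℝ) (s : S → ℝ) (h : ℝ) (x : S) : ℝ :=
  √(modelDensity P μ (θ + h) x) - √(modelDensity P μ θ x)
    - 1 / 2 * h * s x * √(modelDensity P μ θ x)

section Score

variable {S : Type*} [MeasurableSpace S] {Θ : Set ℝ} {P : ℝ → Measure S} {μ : Measure S}

lemma measurable_modelDensity (P : ℝ → Measure S) (μ : Measure S) (t : ℝ) :
    Measurable (modelDensity P μ t) :=
  (Measure.measurable_rnDeriv _ _).ennreal_toReal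

lemma modelDensity_nonneg (P : ℝ → Measure S) (μ : Measure S) (t : ℝ) (x : S) :
    0 ≤ modelDensity P μ t x := ENNReal.toReal_nonneg

lemma measurable_dqmRemainder {s : S → ℝ} (hs : Measurable s) (θ h : ℝ) :
    Measurable (dqmRemainder P μ θ s h) := by
  have h1 := measurable_modelDensity P μ (θ + h)
  have h2 := measurable_modelDensity P μ θ
  unfold dqmRemainder
  fun_prop

lemma modelDensity_eq_mul_rnDeriv {κ : Measure S} [SigmaFinite μ] [SigmaFinite κ] {t : ℝ}
    [SigmaFinite (P t)] (h : P t ≪ μ) :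
    ∀ᵐ x ∂κ, modelDensity P κ t x = (μ.rnDeriv κ x).toReal * modelDensity P μ t x := by
  filter_upwards [Measure.rnDeriv_mul_rnDeriv (κ := κ) h] with x hx
  simp only [modelDensity, ← hx, Pi.mul_apply, ENNReal.toReal_mul]
  ring

/-- The integrated squared remainder does not depend on the dominating measure. -/
lemma lintegral_dqmRemainder_sq {κ : Measure S} [SigmaFinite μ] [SigmaFinite κ] (hμκ : μ ≪ κ)
    {θ h : ℝ} [SigmaFinite (P θ)] [SigmaFinite (P (θ + h))] (h1 : P θ ≪ μ) (h2 : P (θ + h) ≪ μ)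
    {s : S → ℝ} (hs : Measurable s) :
    ∫⁻ x, ENNReal.ofReal (dqmRemainder P κ θ s h x ^ 2) ∂κ
      = ∫⁻ x, ENNReal.ofReal (dqmRemainder P μ θ s h x ^ 2) ∂μ := by
  rw [← lintegral_rnDeriv_mul hμκ
    ((measurable_dqmRemainder hs θ h).pow_const 2).ennreal_ofReal.aemeasurable]
  refine lintegral_congr_ae ?_
  filter_upwards [modelDensity_eq_mul_rnDeriv (κ := κ) h1,
    modelDensity_eq_mul_rnDeriv (κ := κ) h2, Measure.rnDeriv_lt_top μ κ] with x hx1 hx2 hx3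
  have : dqmRemainder P κ θ s h x ^ 2
      = (μ.rnDeriv κ x).toReal * dqmRemainder P μ θ s h x ^ 2 := by
    have hw : √(μ.rnDeriv κ x).toReal ^ 2 = (μ.rnDeriv κ x).toReal :=
      Real.sq_sqrt ENNReal.toReal_nonneg
    rw [dqmRemainder, hx1, hx2, Real.sqrt_mul ENNReal.toReal_nonneg,
      Real.sqrt_mul ENNReal.toReal_nonneg]
    conv_rhs => rw [← hw]
    rw [dqmRemainder]
    ring
  rw [this, ENNReal.ofReal_mul ENNReal.toReal_nonneg, ENNReal.ofReal_toReal hx3.ne]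

lemma IsDQMScore.eventually_mem {θ : ℝ} {s : S → ℝ} (H : IsDQMScore Θ P μ θ s) :
    ∀ᶠ h in 𝓝 (0 : ℝ), θ + h ∈ Θ := by
  have : Tendsto (fun h : ℝ => θ + h) (𝓝 0) (𝓝 θ) := by
    have hc : Continuous fun h : ℝ => θ + h := by fun_prop
    simpa using hc.tendsto 0
  exact this (mem_interior_iff_mem_nhds.1 H.mem_interior)

lemma IsDQMScore.mem {θ : ℝ} {s : S → ℝ} (H : IsDQMScore Θ P μ θ s) : θ ∈ Θ :=
  interior_subset H.mem_interior

lemma IsDQMScore.of_absolutelyContinuous {κ : Measure S} [SigmaFinite κ] (hμκ : μ ≪ κ) {θ : ℝ}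
    {s : S → ℝ} (hP : ∀ t ∈ Θ, SigmaFinite (P t)) (H : IsDQMScore Θ P μ θ s) :
    IsDQMScore Θ P κ θ s where
  sigmaFinite := inferInstance
  dominated t ht := (H.dominated t ht).trans hμκ
  mem_interior := H.mem_interior
  measurable_score := H.measurable_score
  isLittleO := by
    refine H.isLittleO.congr' ?_
    filter_upwards [H.eventually_mem.filter_mono nhdsWithin_le_nhds] with h hh
    have := hP _ H.mem
    have := hP _ hh
    have := H.sigmaFinite
    congr 1
    exact (lintegral_dqmRemainder_sq hμκ (H.dominated _ H.mem) (H.dominated _ hh)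
      H.measurable_score).symm

/-- Two scores with respect to the same dominating measure agree almost everywhere: the difference
of the remainders is `(h / 2) (s₂ - s₁) √p_θ`. -/
lemma IsDQMScore.ae_eq_of_same {θ : ℝ} {s₁ s₂ : S → ℝ} (H₁ : IsDQMScore Θ P μ θ s₁)
    (H₂ : IsDQMScore Θ P μ θ s₂) :
    ∀ᵐ x ∂μ, (s₁ x - s₂ x) * √(modelDensity P μ θ x) = 0 := by
  set d : S → ℝ := fun x => (s₁ x - s₂ x) * √(modelDensity P μ θ x) with hd
  have hdm : Measurable d :=
    (H₁.measurable_score.sub H₂.measurable_score).mul (measurable_modelDensity P μ θ).sqrt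
  have hlim : Tendsto (fun h : ℝ => 8 *
      ((∫⁻ x, ENNReal.ofReal (dqmRemainder P μ θ s₁ h x ^ 2) ∂μ) / ENNReal.ofReal (h ^ 2)
      + (∫⁻ x, ENNReal.ofReal (dqmRemainder P μ θ s₂ h x ^ 2) ∂μ) / ENNReal.ofReal (h ^ 2)))
      (𝓝[≠] 0) (𝓝 0) := by
    have := ENNReal.Tendsto.const_mul (a := 8) (H₁.isLittleO.add H₂.isLittleO)
      (Or.inr (by norm_num))
    simpa [dqmRemainder] using this
  have hle : ∀ᶠ h in 𝓝[≠] (0 : ℝ), ∫⁻ x, ENNReal.ofReal (d x ^ 2) ∂μ ≤ 8 *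
      ((∫⁻ x, ENNReal.ofReal (dqmRemainder P μ θ s₁ h x ^ 2) ∂μ) / ENNReal.ofReal (h ^ 2)
      + (∫⁻ x, ENNReal.ofReal (dqmRemainder P μ θ s₂ h x ^ 2) ∂μ) / ENNReal.ofReal (h ^ 2)) := by
    filter_upwards [self_mem_nhdsWithin] with h hh
    have hh2 : 0 < h ^ 2 := by have : h ≠ 0 := hh; positivity
    rw [← ENNReal.add_div, ← mul_div_assoc, ENNReal.le_div_iff_mul_le (Or.inl (by simpa using hh)) (by simp),
      ← lintegral_mul_const' _ _ (by simp),
      ← lintegral_add_left ((measurable_dqmRemainder H₁.measurable_score θ h).pow_const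
        2).ennreal_ofReal, ← lintegral_const_mul' _ _ (by simp)]
    refine lintegral_mono fun x => ?_
    dsimp only
    rw [← ENNReal.ofReal_mul (by positivity), ← ENNReal.ofReal_add (by positivity) (by positivity),
      show (8 : ENNReal) = ENNReal.ofReal 8 by norm_num, ← ENNReal.ofReal_mul (by norm_num)]
    refine ENNReal.ofReal_le_ofReal ?_
    have : d x * h = 2 * (dqmRemainder P μ θ s₂ h x - dqmRemainder P μ θ s₁ h x) := by
      simp only [hd, dqmRemainder]; ring
    rw [← mul_pow, this]
    nlinarith [sq_nonneg (dqmRemainder P μ θ s₂ h x + dqmRemainder P μ θ s₁ h x)]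
  have h0 : ∫⁻ x, ENNReal.ofReal (d x ^ 2) ∂μ = 0 :=
    le_antisymm (ge_of_tendsto hlim hle) zero_le
  rw [lintegral_eq_zero_iff (hdm.pow_const 2).ennreal_ofReal] at h0
  filter_upwards [h0] with x hx
  have : d x ^ 2 ≤ 0 := by simpa using hx
  exact pow_eq_zero_iff two_ne_zero |>.1 (le_antisymm this (sq_nonneg _))

lemma IsDQMScore.integral_eq {θ : ℝ} {s : S → ℝ} (H : IsDQMScore Θ P μ θ s)
    [SigmaFinite (P θ)] (f : S → ℝ) :
    ∫ x, f x ∂(P θ) = ∫ x, modelDensity P μ θ x * f x ∂μ := by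
  have := H.sigmaFinite
  exact (integral_rnDeriv_smul (H.dominated θ H.mem)).symm

/-- The Fisher information can be computed from any score, with respect to any dominating
measure. -/
lemma IsDQMScore.fisherInfo_eq {θ : ℝ} {s : S → ℝ} (H : IsDQMScore Θ P μ θ s)
    (hP : ∀ t ∈ Θ, SigmaFinite (P t)) :
    fisherInfo Θ P θ = ∫ x, s x ^ 2 ∂(P θ) := by
  have hex : ∃ s : S → ℝ, ∃ μ : Measure S, IsDQMScore Θ P μ θ s := ⟨s, μ, H⟩
  rw [fisherInfo, dif_pos hex]
  obtain ⟨μ', H'⟩ := hex.choose_spec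
  set s' := hex.choose
  have := H.sigmaFinite
  have := H'.sigmaFinite
  have K := H.of_absolutelyContinuous (κ := μ + μ') (Measure.AbsolutelyContinuous.rfl.add_right _) hP
  have K' := H'.of_absolutelyContinuous (κ := μ + μ')
    (by rw [add_comm]; exact Measure.AbsolutelyContinuous.rfl.add_right _) hP
  have := hP θ H.mem
  rw [K.integral_eq, K.integral_eq]
  refine integral_congr_ae ?_
  filter_upwards [K.ae_eq_of_same K'] with x hx
  rcases mul_eq_zero.1 hx with hx | hx
  · rw [sub_eq_zero.1 hx]
  · rw [(Real.sqrt_eq_zero (modelDensity_nonneg _ _ _ _)).1 hx]; simp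

end Score

/-! ### Models with densities bounded away from zero -/

lemma abs_sqrt_sub_sqrt_sub_le {a x y h G C e : ℝ} (ha : 0 < a) (hx : a ≤ x) (hy : a ≤ y)
    (he : 0 < e) (hG : |G| ≤ C) (hd : |y - x - h * G| ≤ e * |h|) (hh : |h| * (C * (e + C)) ≤ e) :
    |√y - √x - 1 / 2 * h * (G / x) * √x| ≤ |h| * (e * (1 / (2 * √a) + 1 / (8 * √a ^ 3))) := by
  have hA : 0 < √a := Real.sqrt_pos.2 ha
  set A := √a
  have hC : 0 ≤ C := (abs_nonneg G).trans hG
  obtain ⟨X, hX⟩ : ∃ X, X = √x := ⟨_, rfl⟩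
  obtain ⟨Y, hY⟩ : ∃ Y, Y = √y := ⟨_, rfl⟩
  have hAX : A ≤ X := hX ▸ Real.sqrt_le_sqrt hx
  have hAY : A ≤ Y := hY ▸ Real.sqrt_le_sqrt hy
  have hxX : x = X ^ 2 := by rw [hX, Real.sq_sqrt (ha.le.trans hx)]
  have hyY : y = Y ^ 2 := by rw [hY, Real.sq_sqrt (ha.le.trans hy)]
  have hX0 : 0 < X := hA.trans_le hAX
  have hY0 : 0 < Y := hA.trans_le hAY
  rw [← hX, ← hY]
  rw [hxX, hyY] at hd
  rw [hxX]
  have key : Y - X - 1 / 2 * h * (G / X ^ 2) * X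
      = (Y ^ 2 - X ^ 2 - h * G) / (X + Y) + h * G * (X - Y) / (2 * X * (X + Y)) := by
    field_simp; ring
  have hYX : |X - Y| ≤ |h| * (e + C) / (2 * A) := by
    rw [le_div_iff₀ (by positivity)]
    calc |X - Y| * (2 * A) ≤ |X - Y| * (X + Y) := by gcongr; linarith
      _ = |Y ^ 2 - X ^ 2| := by
        rw [← abs_neg (Y ^ 2 - X ^ 2), show -(Y ^ 2 - X ^ 2) = (X - Y) * (X + Y) by ring, abs_mul,
          abs_of_pos (show 0 < X + Y by positivity)]
      _ = |(Y ^ 2 - X ^ 2 - h * G) + h * G| := by ring_nf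
      _ ≤ e * |h| + |h| * C := by
        refine (abs_add_le _ _).trans (add_le_add hd ?_)
        rw [abs_mul]; gcongr
      _ = |h| * (e + C) := by ring
  rw [key]
  refine (abs_add_le _ _).trans ?_
  have h1 : |(Y ^ 2 - X ^ 2 - h * G) / (X + Y)| ≤ e * |h| / (2 * A) := by
    rw [abs_div, abs_of_pos (show 0 < X + Y by positivity)]
    gcongr; linarith
  have h2 : |h * G * (X - Y) / (2 * X * (X + Y))| ≤ |h| * e / (8 * A ^ 3) := by
    rw [abs_div, abs_of_pos (show 0 < 2 * X * (X + Y) by positivity), abs_mul, abs_mul]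
    calc |h| * |G| * |X - Y| / (2 * X * (X + Y))
        ≤ |h| * C * (|h| * (e + C) / (2 * A)) / (2 * A * (2 * A)) := by
          gcongr; linarith
      _ = |h| * (|h| * (C * (e + C))) / (8 * A ^ 3) := by field_simp; ring
      _ ≤ |h| * e / (8 * A ^ 3) := by gcongr
  calc _ ≤ e * |h| / (2 * A) + |h| * e / (8 * A ^ 3) := add_le_add h1 h2
    _ = _ := by ring

/-- If the densities are bounded away from zero and differentiable in the parameter, uniformly in
the observation, with bounded derivative `G`, then the model is differentiable in quadratic mean
with score `G / g_θ`. -/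
theorem isDQMScore_of_bounded {Z : Type*} [MeasurableSpace Z] {Θ : Set ℝ} {R : ℝ → Measure Z}
    {ν : Measure Z} [IsFiniteMeasure ν] {θ a C : ℝ} (hθ : θ ∈ interior Θ) (ha : 0 < a)
    (hac : ∀ t ∈ Θ, R t ≪ ν) (hg : ∀ t ∈ Θ, ∀ᵐ z ∂ν, a ≤ modelDensity R ν t z)
    {G : Z → ℝ} (hGm : Measurable G) (hG : ∀ᵐ z ∂ν, |G z| ≤ C)
    (hder : ∀ e > 0, ∀ᶠ h in 𝓝 (0 : ℝ), ∀ᵐ z ∂ν,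
      |modelDensity R ν (θ + h) z - modelDensity R ν θ z - h * G z| ≤ e * |h|) :
    IsDQMScore Θ R ν θ (fun z => G z / modelDensity R ν θ z) where
  sigmaFinite := inferInstance
  dominated := hac
  mem_interior := hθ
  measurable_score := hGm.div (measurable_modelDensity R ν θ)
  isLittleO := by
    rw [ENNReal.tendsto_nhds_zero]
    intro ε hε
    set k := 1 / (2 * √a) + 1 / (8 * √a ^ 3)
    obtain ⟨e, he, heε⟩ : ∃ e : ℝ, 0 < e ∧ ENNReal.ofReal ((e * k) ^ 2) * ν Set.univ ≤ ε := by
      have hlim : Tendsto (fun e : ℝ => ENNReal.ofReal ((e * k) ^ 2) * ν Set.univ)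
          (𝓝[>] 0) (𝓝 0) := by
        have hc : Continuous fun e : ℝ => (e * k) ^ 2 := by fun_prop
        have h1 := ENNReal.Tendsto.mul_const (b := ν Set.univ)
          (ENNReal.tendsto_ofReal (hc.tendsto 0)) (Or.inr (measure_ne_top _ _))
        simpa using h1.mono_left nhdsWithin_le_nhds
      obtain ⟨e, h1, h2⟩ := ((ENNReal.tendsto_nhds_zero.1 hlim ε hε).and
        self_mem_nhdsWithin).exists
      exact ⟨e, h2, h1⟩
    have hmem : ∀ᶠ h in 𝓝 (0 : ℝ), θ + h ∈ Θ := by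
      have hc : Continuous fun h : ℝ => θ + h := by fun_prop
      exact hc.tendsto' 0 θ (by simp) (mem_interior_iff_mem_nhds.1 hθ)
    have hsmall : ∀ᶠ h in 𝓝 (0 : ℝ), |h| * (C * (e + C)) < e := by
      have hc : Continuous fun h : ℝ => |h| * (C * (e + C)) := by fun_prop
      exact hc.tendsto' 0 0 (by simp) (gt_mem_nhds he)
    have hθm : θ ∈ Θ := interior_subset hθ
    filter_upwards [self_mem_nhdsWithin, hmem.filter_mono nhdsWithin_le_nhds,
      hsmall.filter_mono nhdsWithin_le_nhds, (hder e he).filter_mono nhdsWithin_le_nhds]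
      with h hh0 hhm hhs hhd
    have hh2 : 0 < h ^ 2 := by have : h ≠ 0 := hh0; positivity
    refine le_trans ?_ heε
    refine ENNReal.div_le_of_le_mul ?_
    rw [mul_right_comm, ← ENNReal.ofReal_mul (by positivity), ← lintegral_const]
    refine lintegral_mono_ae ?_
    filter_upwards [hg _ hθm, hg _ hhm, hhd, hG] with z h1 h2 h3 h4
    refine ENNReal.ofReal_le_ofReal ?_
    have := abs_sqrt_sub_sqrt_sub_le ha h1 h2 he h4 h3 hhs.le
    rw [← sq_abs]
    calc _ ≤ (|h| * (e * k)) ^ 2 := by gcongr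
      _ = _ := by rw [mul_pow, sq_abs]; ring

/-! ### Differentiability in quadratic mean implies differentiability in `L¹` -/

section L1

variable {S : Type*} [MeasurableSpace S] {Θ : Set ℝ} {P : ℝ → Measure S} {μ : Measure S}
  {θ : ℝ} {s : S → ℝ}

lemma integrable_modelDensity (P : ℝ → Measure S) (μ : Measure S) (t : ℝ) [IsFiniteMeasure (P t)] :
    Integrable (modelDensity P μ t) μ :=
  Measure.integrable_toReal_rnDeriv

lemma IsDQMScore.integral_modelDensity (H : IsDQMScore Θ P μ θ s) {t : ℝ} (ht : t ∈ Θ)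
    [IsProbabilityMeasure (P t)] : ∫ x, modelDensity P μ t x ∂μ = 1 := by
  have := H.sigmaFinite
  have h := Measure.setIntegral_toReal_rnDeriv (H.dominated t ht) Set.univ
  simpa [modelDensity] using h

/-- Real-valued form of the quadratic mean expansion. -/
lemma IsDQMScore.eventually_integral_sq_le (H : IsDQMScore Θ P μ θ s) {e : ℝ} (he : 0 < e) :
    ∀ᶠ h in 𝓝[≠] (0 : ℝ), Integrable (fun x => dqmRemainder P μ θ s h x ^ 2) μ ∧
      ∫ x, dqmRemainder P μ θ s h x ^ 2 ∂μ ≤ e * h ^ 2 := by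
  have h1 := ENNReal.tendsto_nhds_zero.1 H.isLittleO (ENNReal.ofReal e) (by simpa using he)
  filter_upwards [h1, self_mem_nhdsWithin] with h hh hh0
  have hh2 : 0 < h ^ 2 := by have : h ≠ 0 := hh0; positivity
  have h3 : ∫⁻ x, ENNReal.ofReal (dqmRemainder P μ θ s h x ^ 2) ∂μ
      ≤ ENNReal.ofReal (e * h ^ 2) := by
    rw [ENNReal.ofReal_mul he.le]
    exact (ENNReal.div_le_iff_le_mul (Or.inl (by simpa using hh0)) (by simp)).1 hh
  have hm : AEStronglyMeasurable (fun x => dqmRemainder P μ θ s h x ^ 2) μ :=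
    ((measurable_dqmRemainder H.measurable_score θ h).pow_const 2).aestronglyMeasurable
  constructor
  · refine ⟨hm, ?_⟩
    rw [hasFiniteIntegral_iff_ofReal (.of_forall fun x => sq_nonneg _)]
    exact h3.trans_lt ENNReal.ofReal_lt_top
  · rw [integral_eq_lintegral_of_nonneg_ae (.of_forall fun x => sq_nonneg _) hm]
    exact ENNReal.toReal_le_of_le_ofReal (by positivity) h3

lemma IsDQMScore.integrable_sq_mul (H : IsDQMScore Θ P μ θ s)
    (hP : ∀ t ∈ Θ, IsProbabilityMeasure (P t)) :
    Integrable (fun x => s x ^ 2 * modelDensity P μ θ x) μ := by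
  obtain ⟨h, ⟨⟨h1, -⟩, h2⟩, h3⟩ := (((H.eventually_integral_sq_le one_pos).and
    (H.eventually_mem.filter_mono nhdsWithin_le_nhds)).and self_mem_nhdsWithin).exists
  have h0 : h ≠ 0 := h3
  have := hP _ H.mem
  have := hP _ h2
  have hi := ((h1.add (integrable_modelDensity P μ (θ + h))).add
    (integrable_modelDensity P μ θ)).const_mul (12 / h ^ 2)
  refine hi.mono' ((H.measurable_score.pow_const 2).mul
    (measurable_modelDensity P μ θ)).aestronglyMeasurable (.of_forall fun x => ?_)
  have e1 := Real.sq_sqrt (modelDensity_nonneg P μ θ x)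
  have e2 := Real.sq_sqrt (modelDensity_nonneg P μ (θ + h) x)
  have hnn : 0 ≤ s x ^ 2 * modelDensity P μ θ x :=
    mul_nonneg (sq_nonneg _) (modelDensity_nonneg P μ θ x)
  rw [Real.norm_of_nonneg hnn, div_mul_eq_mul_div, le_div_iff₀ (by positivity)]
  simp only [Pi.add_apply, dqmRemainder]
  set p := modelDensity P μ θ x
  set q := modelDensity P μ (θ + h) x
  conv_lhs => rw [← e1]
  rw [← e1, ← e2, Real.sqrt_sq (Real.sqrt_nonneg _), Real.sqrt_sq (Real.sqrt_nonneg _)]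
  set y := √q
  set z := √p
  set w := s x * z * h with hw
  have : s x ^ 2 * z ^ 2 * h ^ 2 = w ^ 2 := by rw [hw]; ring
  rw [this, show (1 : ℝ) / 2 * h * s x * z = w / 2 by rw [hw]; ring]
  nlinarith [sq_nonneg (y - z - w / 2 + y), sq_nonneg (z - (y - z - w / 2)), sq_nonneg (y + z)]

lemma abs_mul_le_one_add_sq_mul {a p : ℝ} (hp : 0 ≤ p) : |a * p| ≤ p + a ^ 2 * p := by
  rw [abs_mul, abs_of_nonneg hp, ← one_add_mul]
  gcongr
  nlinarith [sq_abs a, sq_nonneg (|a| - 1), abs_nonneg a]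

lemma IsDQMScore.integrable_mul (H : IsDQMScore Θ P μ θ s)
    (hP : ∀ t ∈ Θ, IsProbabilityMeasure (P t)) :
    Integrable (fun x => s x * modelDensity P μ θ x) μ := by
  have := hP _ H.mem
  refine ((integrable_modelDensity P μ θ).add (H.integrable_sq_mul hP)).mono'
    (H.measurable_score.mul (measurable_modelDensity P μ θ)).aestronglyMeasurable
    (.of_forall fun x => abs_mul_le_one_add_sq_mul (modelDensity_nonneg P μ θ x))

/-- The densities of a model that is differentiable in quadratic mean are differentiable in
`L¹(μ)`, with derivative `s_θ p_θ`. -/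
lemma IsDQMScore.eventually_integral_abs_le (H : IsDQMScore Θ P μ θ s)
    (hP : ∀ t ∈ Θ, IsProbabilityMeasure (P t)) {e : ℝ} (he : 0 < e) :
    ∀ᶠ h in 𝓝 (0 : ℝ), ∫ x, |modelDensity P μ (θ + h) x - modelDensity P μ θ x
      - h * (s x * modelDensity P μ θ x)| ∂μ ≤ e * |h| := by
  set U := ∫ x, s x ^ 2 * modelDensity P μ θ x ∂μ
  have hU : 0 ≤ U := integral_nonneg fun x => mul_nonneg (sq_nonneg _) (modelDensity_nonneg P μ θ x)
  -- the expansion is used with `δ² h²` in place of `e h²`, where `δ` is a fraction of `e`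
  set δ := e / 6 with hδ
  have hδ0 : 0 < δ := by positivity
  have hsmall : ∀ᶠ h in 𝓝 (0 : ℝ), |h| * (δ ^ 2 + U) < δ := by
    have hc : Continuous fun h : ℝ => |h| * (δ ^ 2 + U) := by fun_prop
    exact hc.tendsto' 0 0 (by simp) (gt_mem_nhds hδ0)
  have hmain : ∀ᶠ h in 𝓝[≠] (0 : ℝ), ∫ x, |modelDensity P μ (θ + h) x - modelDensity P μ θ x
      - h * (s x * modelDensity P μ θ x)| ∂μ ≤ e * |h| := by
    filter_upwards [self_mem_nhdsWithin, hsmall.filter_mono nhdsWithin_le_nhds,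
      H.eventually_mem.filter_mono nhdsWithin_le_nhds,
      H.eventually_integral_sq_le (e := δ ^ 2) (by positivity)] with h h0 hs hm ⟨hr, hr2⟩
    have hh : 0 < |h| := abs_pos.2 h0
    have := hP _ H.mem
    have := hP _ hm
    have hp := integrable_modelDensity P μ θ
    have hq := integrable_modelDensity P μ (θ + h)
    have hu := H.integrable_sq_mul hP
    set l := δ * |h| with hl
    have hl0 : 0 < l := by positivity
    have hptw : ∀ x, |modelDensity P μ (θ + h) x - modelDensity P μ θ x
        - h * (s x * modelDensity P μ θ x)| ≤
        (1 / (2 * l) + 1 / 4) * dqmRemainder P μ θ s h x ^ 2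
          + l * (modelDensity P μ (θ + h) x + modelDensity P μ θ x)
          + h ^ 2 / 2 * (s x ^ 2 * modelDensity P μ θ x) := by
      intro x
      have e1 := Real.sq_sqrt (modelDensity_nonneg P μ θ x)
      have e2 := Real.sq_sqrt (modelDensity_nonneg P μ (θ + h) x)
      have hrx : dqmRemainder P μ θ s h x = √(modelDensity P μ (θ + h) x)
        - √(modelDensity P μ θ x) - 1 / 2 * h * s x * √(modelDensity P μ θ x) := rfl
      set r := dqmRemainder P μ θ s h x
      set p := modelDensity P μ θ x
      set q := modelDensity P μ (θ + h) x
      rw [← e1, ← e2]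
      set y := √q
      set z := √p
      set v := h * s x * z with hv
      have hy : y = r + z + v / 2 := by rw [hrx, hv]; ring
      have hd : y ^ 2 - z ^ 2 - h * (s x * z ^ 2) = r * (y + z) + v * r / 2 + v ^ 2 / 4 := by
        have : h * (s x * z ^ 2) = v * z := by rw [hv]; ring
        rw [this, hy]; ring
      have hv2 : h ^ 2 / 2 * (s x ^ 2 * z ^ 2) = v ^ 2 / 2 := by rw [hv]; ring
      rw [hd, hv2]
      have t1 : |r * (y + z)| ≤ 1 / (2 * l) * r ^ 2 + l * (y ^ 2 + z ^ 2) := by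
        have k1 : 1 / (2 * l) * r ^ 2 + l / 2 * (y + z) ^ 2 - |r * (y + z)|
            = (|r| - l * |y + z|) ^ 2 / (2 * l) := by
          rw [abs_mul, sub_sq, mul_pow, sq_abs, sq_abs]
          field_simp
          ring
        have k2 : 0 ≤ (|r| - l * |y + z|) ^ 2 / (2 * l) := by positivity
        have k3 : l / 2 * (y + z) ^ 2 ≤ l * (y ^ 2 + z ^ 2) := by
          nlinarith [mul_nonneg hl0.le (sq_nonneg (y - z))]
        linarith
      have t2 : |v * r / 2| ≤ r ^ 2 / 4 + v ^ 2 / 4 := by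
        rw [abs_le]; constructor <;> nlinarith [sq_nonneg (v - r), sq_nonneg (v + r)]
      have t3 : |v ^ 2 / 4| = v ^ 2 / 4 := abs_of_nonneg (by positivity)
      have t4 := abs_add_three (r * (y + z)) (v * r / 2) (v ^ 2 / 4)
      linarith
    have i1 : Integrable (fun x => (1 / (2 * l) + 1 / 4) * dqmRemainder P μ θ s h x ^ 2) μ :=
      hr.const_mul _
    have i2 : Integrable (fun x => l * (modelDensity P μ (θ + h) x + modelDensity P μ θ x)) μ :=
      (hq.add hp).const_mul _
    have i3 : Integrable (fun x => h ^ 2 / 2 * (s x ^ 2 * modelDensity P μ θ x)) μ :=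
      hu.const_mul _
    have i12 : Integrable (fun x => (1 / (2 * l) + 1 / 4) * dqmRemainder P μ θ s h x ^ 2
      + l * (modelDensity P μ (θ + h) x + modelDensity P μ θ x)) μ := i1.add i2
    refine (integral_mono_of_nonneg (.of_forall fun x => abs_nonneg _) (i12.add i3)
      (.of_forall hptw)).trans ?_
    rw [integral_add' i12 i3, integral_add i1 i2, integral_const_mul,
      integral_const_mul, integral_const_mul, integral_add hq hp,
      H.integral_modelDensity H.mem, H.integral_modelDensity hm]
    calc (1 / (2 * l) + 1 / 4) * (∫ x, dqmRemainder P μ θ s h x ^ 2 ∂μ) + l * (1 + 1)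
          + h ^ 2 / 2 * U
        ≤ (1 / (2 * l) + 1 / 4) * (δ ^ 2 * h ^ 2) + l * (1 + 1) + h ^ 2 / 2 * U := by gcongr
      _ = |h| * (5 / 2 * δ + |h| * (δ ^ 2 / 4 + U / 2)) := by
        rw [hl, ← sq_abs h]; field_simp; ring
      _ ≤ |h| * (5 / 2 * δ + |h| * (δ ^ 2 + U)) := by
        gcongr <;> nlinarith [sq_nonneg δ]
      _ ≤ |h| * (5 / 2 * δ + δ) := by gcongr
      _ ≤ e * |h| := by rw [mul_comm e]; gcongr; rw [hδ]; linarith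
  rw [eventually_nhdsWithin_iff] at hmain
  filter_upwards [hmain] with h hh
  rcases eq_or_ne h 0 with rfl | h0
  · simp
  · exact hh h0

/-- The densities of a model that is differentiable in quadratic mean are continuous in `L¹(μ)`. -/
lemma IsDQMScore.tendsto_integral_abs_sub (H : IsDQMScore Θ P μ θ s)
    (hP : ∀ t ∈ Θ, IsProbabilityMeasure (P t)) :
    Tendsto (fun t => ∫ x, |modelDensity P μ t x - modelDensity P μ θ x| ∂μ) (𝓝 θ) (𝓝 0) := by
  set V := ∫ x, |s x * modelDensity P μ θ x| ∂μ
  have hlim : Tendsto (fun t => 1 * |t - θ| + |t - θ| * V) (𝓝 θ) (𝓝 0) := by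
    have hc : Continuous fun t : ℝ => 1 * |t - θ| + |t - θ| * V := by fun_prop
    exact hc.tendsto' θ 0 (by simp)
  have hsub : Tendsto (fun t => t - θ) (𝓝 θ) (𝓝 0) := by
    have hc : Continuous fun t : ℝ => t - θ := by fun_prop
    exact hc.tendsto' θ 0 (by simp)
  refine tendsto_of_tendsto_of_tendsto_of_le_of_le' tendsto_const_nhds hlim
    (.of_forall fun t => integral_nonneg fun x => abs_nonneg _) ?_
  filter_upwards [hsub.eventually (H.eventually_integral_abs_le hP one_pos),
    hsub.eventually H.eventually_mem] with t ht htm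
  rw [add_sub_cancel] at ht htm
  have := hP _ H.mem
  have := hP _ htm
  have hi := ((integrable_modelDensity P μ t).sub (integrable_modelDensity P μ θ))
  have hsp := H.integrable_mul hP
  have i1 := (hi.sub (hsp.const_mul (t - θ))).abs
  have i2 := hsp.abs.const_mul |t - θ|
  calc ∫ x, |modelDensity P μ t x - modelDensity P μ θ x| ∂μ
      ≤ ∫ x, (|modelDensity P μ t x - modelDensity P μ θ x
        - (t - θ) * (s x * modelDensity P μ θ x)|
          + |t - θ| * |s x * modelDensity P μ θ x|) ∂μ := by
        refine integral_mono hi.abs (i1.add i2) fun x => ?_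
        dsimp only
        rw [← abs_mul]
        refine le_trans (le_of_eq ?_) (abs_add_le _ _)
        simp
    _ = (∫ x, |modelDensity P μ t x - modelDensity P μ θ x
        - (t - θ) * (s x * modelDensity P μ θ x)| ∂μ) + |t - θ| * V := by
        rw [← integral_const_mul]; exact integral_add i1 i2
    _ ≤ _ := by gcongr

end L1

/-! ### Densities of set functions -/

/-- `g` is a `ν`-density of the set function `D`. -/
structure IsSetDensity {Z : Type*} [MeasurableSpace Z] (ν : Measure Z) (D : Set Z → ℝ)
    (g : Z → ℝ) : Prop where
  measurable : Measurable g
  integrable : Integrable g ν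
  setIntegral_eq : ∀ A, MeasurableSet A → ∫ z in A, g z ∂ν = D A

section SetDensity

variable {Z : Type*} [MeasurableSpace Z] {ν : Measure Z} {D D₁ D₂ : Set Z → ℝ} {g g₁ g₂ : Z → ℝ}

lemma IsSetDensity.sub (h₁ : IsSetDensity ν D₁ g₁) (h₂ : IsSetDensity ν D₂ g₂) :
    IsSetDensity ν (fun A => D₁ A - D₂ A) (fun z => g₁ z - g₂ z) where
  measurable := h₁.measurable.sub h₂.measurable
  integrable := h₁.integrable.sub h₂.integrable
  setIntegral_eq A hA := by
    rw [integral_sub h₁.integrable.integrableOn h₂.integrable.integrableOn,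
      h₁.setIntegral_eq A hA, h₂.setIntegral_eq A hA]

lemma IsSetDensity.const_mul (h : IsSetDensity ν D g) (a : ℝ) :
    IsSetDensity ν (fun A => a * D A) (fun z => a * g z) where
  measurable := h.measurable.const_mul a
  integrable := h.integrable.const_mul a
  setIntegral_eq A hA := by rw [integral_const_mul, h.setIntegral_eq A hA]

lemma IsSetDensity.congr (h : IsSetDensity ν D₁ g) (hD : ∀ A, MeasurableSet A → D₁ A = D₂ A) :
    IsSetDensity ν D₂ g :=
  ⟨h.measurable, h.integrable, fun A hA => (h.setIntegral_eq A hA).trans (hD A hA)⟩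

lemma IsSetDensity.ae_le [IsFiniteMeasure ν] (h : IsSetDensity ν D g) {b : ℝ}
    (hD : ∀ A, MeasurableSet A → D A ≤ b * ν.real A) : ∀ᵐ z ∂ν, g z ≤ b := by
  refine ae_le_of_forall_setIntegral_le h.integrable (integrable_const b) fun A hA _ => ?_
  rw [h.setIntegral_eq A hA, setIntegral_const, smul_eq_mul, mul_comm]
  exact hD A hA

lemma IsSetDensity.le_ae [IsFiniteMeasure ν] (h : IsSetDensity ν D g) {b : ℝ}
    (hD : ∀ A, MeasurableSet A → b * ν.real A ≤ D A) : ∀ᵐ z ∂ν, b ≤ g z := by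
  refine ae_le_of_forall_setIntegral_le (integrable_const b) h.integrable fun A hA _ => ?_
  rw [h.setIntegral_eq A hA, setIntegral_const, smul_eq_mul, mul_comm]
  exact hD A hA

lemma IsSetDensity.ae_abs_le [IsFiniteMeasure ν] (h : IsSetDensity ν D g) {b : ℝ}
    (hD : ∀ A, MeasurableSet A → |D A| ≤ b * ν.real A) : ∀ᵐ z ∂ν, |g z| ≤ b := by
  filter_upwards [h.ae_le fun A hA => (le_abs_self _).trans (hD A hA),
    h.le_ae (b := -b) fun A hA => by have := neg_abs_le (D A); have := hD A hA; linarith]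
    with z h1 h2
  exact abs_le.2 ⟨h2, h1⟩

lemma IsSetDensity.ae_eq [IsFiniteMeasure ν] (h₁ : IsSetDensity ν D g₁)
    (h₂ : IsSetDensity ν D g₂) : g₁ =ᵐ[ν] g₂ := by
  filter_upwards [(h₁.sub h₂).ae_abs_le (b := 0) (by simp)] with z hz
  exact sub_eq_zero.1 (abs_nonpos_iff.1 hz)

lemma isSetDensity_modelDensity [SigmaFinite ν] {R : ℝ → Measure Z} {t : ℝ}
    [IsFiniteMeasure (R t)] (h : R t ≪ ν) :
    IsSetDensity ν (fun A => (R t).real A) (modelDensity R ν t) where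
  measurable := measurable_modelDensity R ν t
  integrable := integrable_modelDensity R ν t
  setIntegral_eq A _ := Measure.setIntegral_toReal_rnDeriv h A

end SetDensity

/-! ### Kernels comparable to a fixed measure -/

/-- All measures `Q x` agree with `ν` up to a factor `c`. An `α`-private kernel is comparable to
each of its own values, with `c = exp α`. -/
def IsComparable {S Z : Type*} [MeasurableSpace S] [MeasurableSpace Z] (c : ℝ) (Q : Kernel S Z)
    (ν : Measure Z) : Prop :=
  ∀ x A, MeasurableSet A → (Q x).real A ≤ c * ν.real A ∧ ν.real A ≤ c * (Q x).real A

/-- The signed measure `A ↦ ∫ Q(A | x) f(x) μ(dx)`, as a set function. -/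
noncomputable def kernelIntegral {S Z : Type*} [MeasurableSpace S] [MeasurableSpace Z]
    (Q : Kernel S Z) (μ : Measure S) (f : S → ℝ) (A : Set Z) : ℝ :=
  ∫ x, (Q x).real A * f x ∂μ

section Kernel

lemma kernelIntegral_const_mul {S Z : Type*} [MeasurableSpace S] [MeasurableSpace Z]
    {Q : Kernel S Z} {μ : Measure S} {f : S → ℝ} (a : ℝ) (A : Set Z) :
    kernelIntegral Q μ (fun x => a * f x) A = a * kernelIntegral Q μ f A := by
  simp only [kernelIntegral, mul_left_comm _ a]
  exact integral_const_mul _ _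

lemma measurable_kernel_real {S Z : Type*} [MeasurableSpace S] [MeasurableSpace Z]
    {Q : Kernel S Z} {A : Set Z} (hA : MeasurableSet A) : Measurable fun x => (Q x).real A :=
  (Q.measurable_coe hA).ennreal_toReal

variable {S Z : Type*} [MeasurableSpace S] [MeasurableSpace Z] {Q Q' : Kernel S Z}
  [IsMarkovKernel Q] [IsMarkovKernel Q'] {μ : Measure S} {ν : Measure Z} {c : ℝ} {f f' : S → ℝ}

lemma integrable_kernel_mul (hf : Integrable f μ) {A : Set Z} (hA : MeasurableSet A) :
    Integrable (fun x => (Q x).real A * f x) μ := by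
  refine hf.bdd_mul (c := 1) (measurable_kernel_real hA).aestronglyMeasurable
    (.of_forall fun x => ?_)
  rw [Real.norm_of_nonneg measureReal_nonneg]
  exact measureReal_le_one

lemma kernelIntegral_sub (hf : Integrable f μ) (hf' : Integrable f' μ) {A : Set Z}
    (hA : MeasurableSet A) :
    kernelIntegral Q μ (fun x => f x - f' x) A = kernelIntegral Q μ f A - kernelIntegral Q μ f' A := by
  simp only [kernelIntegral, mul_sub]
  exact integral_sub (integrable_kernel_mul hf hA) (integrable_kernel_mul hf' hA)

lemma IsComparable.abs_kernelIntegral_le (hQ : IsComparable c Q ν) (hf : Integrable f μ)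
    {A : Set Z} (hA : MeasurableSet A) :
    |kernelIntegral Q μ f A| ≤ c * (∫ x, |f x| ∂μ) * ν.real A := by
  calc |kernelIntegral Q μ f A| ≤ ∫ x, |(Q x).real A * f x| ∂μ := abs_integral_le_integral_abs
    _ ≤ ∫ x, c * ν.real A * |f x| ∂μ := by
      refine integral_mono (integrable_kernel_mul hf hA).abs (hf.abs.const_mul _) fun x => ?_
      dsimp only
      rw [abs_mul, abs_of_nonneg measureReal_nonneg]
      gcongr
      exact (hQ x A hA).1
    _ = _ := by rw [integral_const_mul]; ring

lemma IsComparable.exists_density_of_nonneg [IsFiniteMeasure ν] (hQ : IsComparable c Q ν)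
    (hf : Integrable f μ) (hf0 : ∀ x, 0 ≤ f x) : ∃ g, IsSetDensity ν (kernelIntegral Q μ f) g := by
  set w : S → ENNReal := fun x => ENNReal.ofReal (f x)
  have hw : AEMeasurable w μ := hf.aemeasurable.ennreal_ofReal
  have : IsFiniteMeasure (μ.withDensity w) := isFiniteMeasure_withDensity_ofReal hf.2
  set m : Measure Z := Q ∘ₘ μ.withDensity w
  have hac : m ≪ ν := by
    refine Measure.AbsolutelyContinuous.mk fun A hA h0 => ?_
    rw [Measure.bind_apply hA Q.measurable.aemeasurable]
    have : ∀ x, Q x A = 0 := by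
      intro x
      have h1 := (hQ x A hA).1
      rw [measureReal_def, measureReal_def, h0, ENNReal.toReal_zero, mul_zero] at h1
      exact ((ENNReal.toReal_eq_zero_iff _).1 (le_antisymm h1 ENNReal.toReal_nonneg)).resolve_right
        (measure_ne_top _ _)
    simp [this]
  refine ⟨fun z => (m.rnDeriv ν z).toReal, (Measure.measurable_rnDeriv _ _).ennreal_toReal,
    Measure.integrable_toReal_rnDeriv, fun A hA => ?_⟩
  rw [Measure.setIntegral_toReal_rnDeriv hac, measureReal_def,
    Measure.bind_apply hA Q.measurable.aemeasurable,
    lintegral_withDensity_eq_lintegral_mul₀ hw (Q.measurable_coe hA).aemeasurable,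
    kernelIntegral, integral_eq_lintegral_of_nonneg_ae
      (.of_forall fun x => mul_nonneg measureReal_nonneg (hf0 x))
      (integrable_kernel_mul hf hA).aestronglyMeasurable]
  congr 1
  refine lintegral_congr fun x => ?_
  rw [ENNReal.ofReal_mul measureReal_nonneg, ofReal_measureReal, mul_comm]
  rfl

lemma IsComparable.exists_density [IsFiniteMeasure ν] (hQ : IsComparable c Q ν)
    (hf : Integrable f μ) : ∃ g, IsSetDensity ν (kernelIntegral Q μ f) g := by
  obtain ⟨g₁, h₁⟩ := hQ.exists_density_of_nonneg hf.pos_part fun x => le_max_right _ _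
  obtain ⟨g₂, h₂⟩ := hQ.exists_density_of_nonneg hf.neg_part fun x => le_max_right _ _
  refine ⟨_, (h₁.sub h₂).congr fun A hA => ?_⟩
  rw [← kernelIntegral_sub hf.pos_part hf.neg_part hA]
  congr 1
  ext x
  exact max_zero_sub_max_neg_zero_eq_self (f x)

end Kernel

section PrivateModel

variable {S Z : Type*} [MeasurableSpace S] [MeasurableSpace Z] {Q Q' : Kernel S Z}
  [IsMarkovKernel Q] [IsMarkovKernel Q'] {μ : Measure S} {ν : Measure Z} {c : ℝ}
  {Θ : Set ℝ} {P : ℝ → Measure S} {θ θ' : ℝ} {s s' : S → ℝ} {G g : Z → ℝ}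

lemma measureReal_comp_eq_kernelIntegral [SigmaFinite μ] {t : ℝ} [IsProbabilityMeasure (P t)]
    (h : P t ≪ μ) {A : Set Z} (hA : MeasurableSet A) :
    (Q ∘ₘ P t).real A = kernelIntegral Q μ (modelDensity P μ t) A := by
  have h1 : kernelIntegral Q μ (modelDensity P μ t) A = ∫ x, (Q x).real A ∂(P t) := by
    rw [← integral_rnDeriv_smul h, kernelIntegral]
    exact integral_congr_ae (.of_forall fun x => mul_comm _ _)
  rw [h1, measureReal_def, Measure.bind_apply hA Q.measurable.aemeasurable,
    integral_eq_lintegral_of_nonneg_ae (.of_forall fun x => measureReal_nonneg)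
      (measurable_kernel_real hA).aestronglyMeasurable]
  congr 1
  exact lintegral_congr fun x => (ofReal_measureReal).symm

lemma IsComparable.le_kernelIntegral_modelDensity (hQ : IsComparable c Q ν)
    (H : IsDQMScore Θ P μ θ s) {t : ℝ} (ht : t ∈ Θ) [IsProbabilityMeasure (P t)] (hc : 0 < c)
    {A : Set Z} (hA : MeasurableSet A) :
    c⁻¹ * ν.real A ≤ kernelIntegral Q μ (modelDensity P μ t) A := by
  calc c⁻¹ * ν.real A = ∫ x, c⁻¹ * ν.real A * modelDensity P μ t x ∂μ := by
        rw [integral_const_mul, H.integral_modelDensity ht, mul_one]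
    _ ≤ _ := by
        refine integral_mono ((integrable_modelDensity P μ t).const_mul _)
          (integrable_kernel_mul (integrable_modelDensity P μ t) hA) fun x => ?_
        dsimp only
        refine mul_le_mul_of_nonneg_right ?_ (modelDensity_nonneg P μ t x)
        rw [inv_mul_le_iff₀ hc]
        exact (hQ x A hA).2

/-- The image of a model under a comparable kernel has bounded densities, so that it inherits
differentiability in quadratic mean from the `L¹`-differentiability of the original densities. Its
Fisher information is computed from `ν`-densities of `QP_θ` and of its derivative. -/
theorem IsComparable.fisherInfo_comp [IsFiniteMeasure ν] (hQ : IsComparable c Q ν) (hc : 0 < c)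
    (H : IsDQMScore Θ P μ θ s) (hP : ∀ t ∈ Θ, IsProbabilityMeasure (P t))
    (hG : IsSetDensity ν (kernelIntegral Q μ fun x => s x * modelDensity P μ θ x) G)
    (hg : IsSetDensity ν (kernelIntegral Q μ (modelDensity P μ θ)) g) :
    fisherInfo Θ (fun t => Q ∘ₘ P t) θ = ∫ z, G z ^ 2 / g z ∂ν := by
  set R : ℝ → Measure Z := fun t => Q ∘ₘ P t with hR
  have := H.sigmaFinite
  have hRP : ∀ t ∈ Θ, IsProbabilityMeasure (R t) := fun t ht => by
    have := hP t ht
    infer_instance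
  have hreal : ∀ t ∈ Θ, ∀ A, MeasurableSet A →
      (R t).real A = kernelIntegral Q μ (modelDensity P μ t) A := fun t ht A hA => by
    have := hP t ht
    exact measureReal_comp_eq_kernelIntegral (H.dominated t ht) hA
  have hac : ∀ t ∈ Θ, R t ≪ ν := fun t ht => by
    refine Measure.AbsolutelyContinuous.mk fun A hA h0 => ?_
    have := hP t ht
    have := hRP t ht
    have h1 := hQ.abs_kernelIntegral_le (integrable_modelDensity P μ t) hA
    rw [← hreal t ht A hA, measureReal_def (μ := ν), h0, ENNReal.toReal_zero, mul_zero] at h1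
    exact (measureReal_eq_zero_iff).1 (abs_nonpos_iff.1 h1)
  have hdens : ∀ t ∈ Θ, IsSetDensity ν (kernelIntegral Q μ (modelDensity P μ t))
      (modelDensity R ν t) := fun t ht => by
    have := hRP t ht
    exact (isSetDensity_modelDensity (hac t ht)).congr (hreal t ht)
  have hsp := H.integrable_mul hP
  have hDQM : IsDQMScore Θ R ν θ (fun z => G z / modelDensity R ν θ z) := by
    refine isDQMScore_of_bounded H.mem_interior (inv_pos.2 hc) hac (fun t ht => ?_) hG.measurable
      (hG.ae_abs_le fun A hA => hQ.abs_kernelIntegral_le hsp hA) fun e he => ?_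
    · have := hP t ht
      exact (hdens t ht).le_ae fun A hA => hQ.le_kernelIntegral_modelDensity H ht hc hA
    · filter_upwards [H.eventually_integral_abs_le hP (e := e / c) (by positivity),
        H.eventually_mem] with h hh hm
      have := hP _ hm
      have := hP _ H.mem
      have hi : Integrable (fun x => modelDensity P μ (θ + h) x - modelDensity P μ θ x) μ :=
        (integrable_modelDensity P μ (θ + h)).sub (integrable_modelDensity P μ θ)
      refine (((hdens _ hm).sub (hdens _ H.mem)).sub (hG.const_mul h)).ae_abs_le fun A hA => ?_
      rw [← kernelIntegral_const_mul, ← kernelIntegral_sub (integrable_modelDensity _ _ _)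
        (integrable_modelDensity _ _ _) hA, ← kernelIntegral_sub hi (hsp.const_mul h) hA]
      refine (hQ.abs_kernelIntegral_le (hi.sub (hsp.const_mul h)) hA).trans
        (mul_le_mul_of_nonneg_right ?_ measureReal_nonneg)
      exact (mul_le_mul_of_nonneg_left hh hc.le).trans (le_of_eq (by field_simp))
  have := hRP θ H.mem
  rw [hDQM.fisherInfo_eq fun t ht => by have := hRP t ht; infer_instance, hDQM.integral_eq]
  refine integral_congr_ae ?_
  have := hP θ H.mem
  filter_upwards [(hdens _ H.mem).ae_eq hg, hg.le_ae (b := c⁻¹) fun A hA =>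
    hQ.le_kernelIntegral_modelDensity H H.mem hc hA] with z hz hz2
  have : 0 < g z := (inv_pos.2 hc).trans_le hz2
  rw [hz]
  field_simp

lemma abs_sq_div_sub_sq_div_le {a B δ G₁ G₂ g₁ g₂ : ℝ} (ha : 0 < a) (h1 : |G₁| ≤ B) (h2 : |G₂| ≤ B)
    (h3 : a ≤ g₁) (h4 : a ≤ g₂) (h5 : |G₁ - G₂| ≤ δ) (h6 : |g₁ - g₂| ≤ δ) :
    |G₁ ^ 2 / g₁ - G₂ ^ 2 / g₂| ≤ δ * (2 * B / a + B ^ 2 / a ^ 2) := by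
  have hg1 : 0 < g₁ := ha.trans_le h3
  have hg2 : 0 < g₂ := ha.trans_le h4
  have hδ : 0 ≤ δ := (abs_nonneg _).trans h5
  have hB : 0 ≤ B := (abs_nonneg _).trans h1
  have key : G₁ ^ 2 / g₁ - G₂ ^ 2 / g₂
      = (G₁ - G₂) * (G₁ + G₂) / g₁ - G₂ ^ 2 * (g₁ - g₂) / (g₁ * g₂) := by
    field_simp; ring
  rw [key]
  refine (abs_sub _ _).trans ?_
  have t1 : |(G₁ - G₂) * (G₁ + G₂) / g₁| ≤ δ * (2 * B) / a := by
    rw [abs_div, abs_mul, abs_of_pos hg1]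
    gcongr
    exact (abs_add_le _ _).trans (by linarith)
  have t2 : |G₂ ^ 2 * (g₁ - g₂) / (g₁ * g₂)| ≤ B ^ 2 * δ / (a * a) := by
    rw [abs_div, abs_mul, abs_of_pos (mul_pos hg1 hg2), abs_pow]
    gcongr
  calc _ ≤ δ * (2 * B) / a + B ^ 2 * δ / (a * a) := add_le_add t1 t2
    _ = _ := by ring

/-- Stability of the Fisher information: only the two signed measures that enter the formula
matter, up to a multiple of `ν`. -/
theorem IsComparable.abs_fisherInfo_sub_le [IsProbabilityMeasure ν] (hQ : IsComparable c Q ν)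
    (hQ' : IsComparable c Q' ν) (hc : 0 < c)
    (H : IsDQMScore Θ P μ θ s) (H' : IsDQMScore Θ P μ θ' s')
    (hP : ∀ t ∈ Θ, IsProbabilityMeasure (P t)) {K δ : ℝ}
    (hK : ∫ x, |s x * modelDensity P μ θ x| ∂μ ≤ K)
    (hK' : ∫ x, |s' x * modelDensity P μ θ' x| ∂μ ≤ K)
    (hs : ∀ A, MeasurableSet A → |kernelIntegral Q μ (fun x => s x * modelDensity P μ θ x) A
      - kernelIntegral Q' μ (fun x => s' x * modelDensity P μ θ' x) A| ≤ δ * ν.real A)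
    (hp : ∀ A, MeasurableSet A → |kernelIntegral Q μ (modelDensity P μ θ) A
      - kernelIntegral Q' μ (modelDensity P μ θ') A| ≤ δ * ν.real A) :
    |fisherInfo Θ (fun t => Q ∘ₘ P t) θ - fisherInfo Θ (fun t => Q' ∘ₘ P t) θ'|
      ≤ δ * (2 * (c * K) / c⁻¹ + (c * K) ^ 2 / c⁻¹ ^ 2) := by
  have := hP θ H.mem
  have := hP θ' H'.mem
  have hsp := H.integrable_mul hP
  have hsp' := H'.integrable_mul hP
  obtain ⟨G, hG⟩ := hQ.exists_density hsp
  obtain ⟨g, hg⟩ := hQ.exists_density (integrable_modelDensity P μ θ)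
  obtain ⟨G', hG'⟩ := hQ'.exists_density hsp'
  obtain ⟨g', hg'⟩ := hQ'.exists_density (integrable_modelDensity P μ θ')
  rw [hQ.fisherInfo_comp hc H hP hG hg, hQ'.fisherInfo_comp hc H' hP hG' hg']
  have b1 : ∀ᵐ z ∂ν, |G z| ≤ c * K := hG.ae_abs_le fun A hA =>
    (hQ.abs_kernelIntegral_le hsp hA).trans (by gcongr)
  have b2 : ∀ᵐ z ∂ν, |G' z| ≤ c * K := hG'.ae_abs_le fun A hA =>
    (hQ'.abs_kernelIntegral_le hsp' hA).trans (by gcongr)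
  have b3 := hg.le_ae fun A hA => hQ.le_kernelIntegral_modelDensity H H.mem hc hA
  have b4 := hg'.le_ae fun A hA => hQ'.le_kernelIntegral_modelDensity H' H'.mem hc hA
  have i1 : Integrable (fun z => G z ^ 2 / g z) ν := by
    refine Integrable.of_bound ((hG.measurable.pow_const 2).div
      hg.measurable).aestronglyMeasurable ((c * K) ^ 2 / c⁻¹) ?_
    filter_upwards [b1, b3] with z h1 h3
    have : 0 < g z := (inv_pos.2 hc).trans_le h3
    rw [Real.norm_eq_abs, abs_div, abs_pow, abs_of_pos this]
    gcongr
  have i2 : Integrable (fun z => G' z ^ 2 / g' z) ν := by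
    refine Integrable.of_bound ((hG'.measurable.pow_const 2).div
      hg'.measurable).aestronglyMeasurable ((c * K) ^ 2 / c⁻¹) ?_
    filter_upwards [b2, b4] with z h1 h3
    have : 0 < g' z := (inv_pos.2 hc).trans_le h3
    rw [Real.norm_eq_abs, abs_div, abs_pow, abs_of_pos this]
    gcongr
  rw [← integral_sub i1 i2, ← Real.norm_eq_abs]
  refine (norm_integral_le_of_norm_le_const (C := δ * (2 * (c * K) / c⁻¹ + (c * K) ^ 2 / c⁻¹ ^ 2))
    ?_).trans (by simp)
  filter_upwards [b1, b2, b3, b4, (hG.sub hG').ae_abs_le hs, (hg.sub hg').ae_abs_le hp]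
    with z h1 h2 h3 h4 h5 h6
  exact abs_sq_div_sub_sq_div_le (inv_pos.2 hc) h1 h2 h3 h4 h5 h6

/-- A bound on the Fisher information that is uniform over comparable kernels. -/
theorem IsComparable.fisherInfo_le [IsProbabilityMeasure ν] (hQ : IsComparable c Q ν)
    (hc : 0 < c) (H : IsDQMScore Θ P μ θ s) (hP : ∀ t ∈ Θ, IsProbabilityMeasure (P t)) :
    fisherInfo Θ (fun t => Q ∘ₘ P t) θ
      ≤ (c * ∫ x, |s x * modelDensity P μ θ x| ∂μ) ^ 2 / c⁻¹ := by
  have := hP θ H.mem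
  have hsp := H.integrable_mul hP
  obtain ⟨G, hG⟩ := hQ.exists_density hsp
  obtain ⟨g, hg⟩ := hQ.exists_density (integrable_modelDensity P μ θ)
  rw [hQ.fisherInfo_comp hc H hP hG hg]
  refine (Real.le_norm_self _).trans ((norm_integral_le_of_norm_le_const
    (C := (c * ∫ x, |s x * modelDensity P μ θ x| ∂μ) ^ 2 / c⁻¹) ?_).trans (by simp))
  filter_upwards [hG.ae_abs_le fun A hA => hQ.abs_kernelIntegral_le hsp hA,
    hg.le_ae fun A hA => hQ.le_kernelIntegral_modelDensity H H.mem hc hA] with z h1 h3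
  have : 0 < g z := (inv_pos.2 hc).trans_le h3
  rw [Real.norm_eq_abs, abs_div, abs_pow, abs_of_pos this]
  gcongr

lemma IsPrivateKernel.isComparable {α : ℝ} (hQ : IsPrivateKernel α Q) (x₀ : S) :
    IsComparable (Real.exp α) Q (Q x₀) := by
  have key : ∀ x x' A, MeasurableSet A → (Q x).real A ≤ Real.exp α * (Q x').real A := by
    intro x x' A hA
    have h := ENNReal.toReal_mono (ENNReal.mul_ne_top ENNReal.ofReal_ne_top (measure_ne_top _ _))
      (hQ A hA x x')
    rwa [ENNReal.toReal_mul, ENNReal.toReal_ofReal (Real.exp_pos _).le] at h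
  exact fun x A hA => ⟨key x x₀ A hA, key x₀ x A hA⟩

end PrivateModel

/-! ### Discretizations -/

section Mixture

variable {R S Z : Type*} [MeasurableSpace R] [MeasurableSpace S] [MeasurableSpace Z] {α : ℝ}
  {Q : Kernel S Z} {η : Kernel R S} [IsMarkovKernel η]

lemma IsPrivateKernel.comp_apply_le (hQ : IsPrivateKernel α Q) {A : Set Z} (hA : MeasurableSet A)
    (r : R) (x : S) : (Q ∘ₖ η) r A ≤ ENNReal.ofReal (Real.exp α) * Q x A := by
  rw [Kernel.comp_apply' _ _ _ hA]
  calc ∫⁻ y, Q y A ∂(η r) ≤ ∫⁻ _, ENNReal.ofReal (Real.exp α) * Q x A ∂(η r) :=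
        lintegral_mono fun y => hQ A hA y x
    _ = _ := by simp

lemma IsPrivateKernel.le_comp_apply (hQ : IsPrivateKernel α Q) {A : Set Z} (hA : MeasurableSet A)
    (r : R) (x : S) : Q x A ≤ ENNReal.ofReal (Real.exp α) * (Q ∘ₖ η) r A := by
  rw [Kernel.comp_apply' _ _ _ hA, ← lintegral_const_mul _ (Q.measurable_coe hA)]
  calc Q x A = ∫⁻ _, Q x A ∂(η r) := by simp
    _ ≤ _ := lintegral_mono fun y => hQ A hA x y

/-- Randomizing the input of a private kernel keeps it private. -/
lemma IsPrivateKernel.comp (hQ : IsPrivateKernel α Q) : IsPrivateKernel α (Q ∘ₖ η) := by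
  intro A hA r r'
  rw [Kernel.comp_apply' Q η r' hA, ← lintegral_const_mul _ (Q.measurable_coe hA)]
  calc (Q ∘ₖ η) r A = ∫⁻ _, (Q ∘ₖ η) r A ∂(η r') := by simp
    _ ≤ _ := lintegral_mono fun y => hQ.comp_apply_le hA r y

lemma IsPrivateKernel.isComparable_comp [IsMarkovKernel Q] (hQ : IsPrivateKernel α Q) (x₀ : S) :
    IsComparable (Real.exp α) (Q ∘ₖ η) (Q x₀) := by
  intro r A hA
  have h1 := ENNReal.toReal_mono (ENNReal.mul_ne_top ENNReal.ofReal_ne_top (measure_ne_top _ _))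
    (hQ.comp_apply_le (η := η) hA r x₀)
  have h2 := ENNReal.toReal_mono (ENNReal.mul_ne_top ENNReal.ofReal_ne_top (measure_ne_top _ _))
    (hQ.le_comp_apply (η := η) hA r x₀)
  rw [ENNReal.toReal_mul, ENNReal.toReal_ofReal (Real.exp_pos _).le] at h1 h2
  exact ⟨h1, h2⟩

end Mixture

lemma Kernel.comap_comp_measure {R S Z : Type*} [MeasurableSpace R] [MeasurableSpace S]
    [MeasurableSpace Z] (Q : Kernel S Z) {T : R → S} (hT : Measurable T) (m : Measure R) :
    Q.comap T hT ∘ₘ m = Q ∘ₘ m.map T := by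
  ext A hA
  rw [Measure.bind_apply hA (Kernel.measurable _).aemeasurable,
    Measure.bind_apply hA (Kernel.measurable _).aemeasurable,
    lintegral_map (Q.measurable_coe hA) hT]
  rfl

lemma integral_abs_le_of_eLpNorm_le {S : Type*} [MeasurableSpace S] {μ : Measure S} {f : S → ℝ}
    (hf : AEStronglyMeasurable f μ) {δ : ℝ} (hδ : 0 ≤ δ)
    (h : eLpNorm f 1 μ ≤ ENNReal.ofReal δ) : ∫ x, |f x| ∂μ ≤ δ := by
  rw [eLpNorm_one_eq_lintegral_enorm] at h
  have := integral_norm_eq_lintegral_enorm hf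
  simp only [Real.norm_eq_abs] at this
  rw [this]
  exact ENNReal.toReal_le_of_le_ofReal hδ h

section Cells

variable {S : Type*} [MeasurableSpace S] {μ : Measure S} (D : Discretization S)

open Classical in
lemma Discretization.cellKernel_apply (x₀ : S) (j : Fin D.k) :
    D.cellKernel μ x₀ j = if 0 < μ (D.T ⁻¹' {j}) ∧ μ (D.T ⁻¹' {j}) < ⊤ then μ[|D.T ⁻¹' {j}]
      else Measure.dirac x₀ := rfl

instance (x₀ : S) : IsMarkovKernel (D.cellKernel μ x₀) := by
  refine ⟨fun j => ?_⟩
  rw [D.cellKernel_apply]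
  split_ifs with h
  · exact cond_isProbabilityMeasure_of_finite h.1.ne' h.2.ne
  · infer_instance

lemma Discretization.measurableSet_cell (j : Fin D.k) : MeasurableSet (D.T ⁻¹' {j}) :=
  D.measurable_T (measurableSet_singleton j)

instance {Z : Type*} [MeasurableSpace Z] (x₀ : S) (Q : Kernel S Z) [IsMarkovKernel Q] :
    IsMarkovKernel (D.avgKernel μ x₀ Q) := by
  rw [Discretization.avgKernel]; infer_instance

/-- Averaging the kernel over cells does not change its integral against an integrable function
that is constant on cells. -/
lemma Discretization.kernelIntegral_comap_avgKernel {Z : Type*} [MeasurableSpace Z] (x₀ : S)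
    (Q : Kernel S Z) [IsMarkovKernel Q] {v : Fin D.k → ℝ} (hv : Integrable (fun x => v (D.T x)) μ)
    {A : Set Z} (hA : MeasurableSet A) :
    kernelIntegral ((D.avgKernel μ x₀ Q).comap D.T D.measurable_T) μ (fun x => v (D.T x)) A
      = kernelIntegral Q μ (fun x => v (D.T x)) A := by
  have hsplit : ∀ (F : S → ℝ), Integrable (fun x => F x * v (D.T x)) μ →
      ∫ x, F x * v (D.T x) ∂μ = ∑ j, ∫ x in D.T ⁻¹' {j}, F x * v (D.T x) ∂μ := by
    intro F hF
    rw [← integral_iUnion_fintype D.measurableSet_cell ?_ fun j => hF.integrableOn]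
    · rw [← Set.preimage_iUnion, Set.iUnion_of_singleton, Set.preimage_univ, setIntegral_univ]
    · intro i j hij
      exact Disjoint.preimage _ (by simpa using hij)
  rw [kernelIntegral, kernelIntegral, hsplit _ (integrable_kernel_mul hv hA),
    hsplit _ (integrable_kernel_mul hv hA)]
  refine Finset.sum_congr rfl fun j _ => ?_
  have hcell : ∀ (F : S → ℝ), ∫ x in D.T ⁻¹' {j}, F x * v (D.T x) ∂μ
      = (∫ x in D.T ⁻¹' {j}, F x ∂μ) * v j := by
    intro F
    rw [← integral_mul_const]
    exact setIntegral_congr_fun (D.measurableSet_cell j) fun x hx => by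
      rw [show D.T x = j from hx]
  rw [hcell, hcell]
  rcases eq_or_ne (v j) 0 with h0 | h0
  · simp [h0]
  congr 1
  have hconst : ∫ x in D.T ⁻¹' {j},
      (((D.avgKernel μ x₀ Q).comap D.T D.measurable_T) x).real A ∂μ
      = μ.real (D.T ⁻¹' {j}) * (D.avgKernel μ x₀ Q j).real A := by
    rw [← smul_eq_mul, ← setIntegral_const]
    exact setIntegral_congr_fun (D.measurableSet_cell j) fun x hx => by
      rw [← show D.T x = j from hx]; rfl
  rw [hconst]
  have hfin : μ (D.T ⁻¹' {j}) < ⊤ := by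
    have h1 : IntegrableOn (fun _ => v j) (D.T ⁻¹' {j}) μ :=
      hv.integrableOn.congr_fun (fun x hx => by rw [← show D.T x = j from hx])
        (D.measurableSet_cell j)
    exact ((integrableOn_const_iff (by simp)).1 h1).resolve_left (by simpa using h0)
  rcases eq_or_ne (μ (D.T ⁻¹' {j})) 0 with hz | hz
  · rw [measureReal_def, hz, setIntegral_measure_zero _ hz]; simp
  have hreal : (D.avgKernel μ x₀ Q j).real A = ∫ x, (Q x).real A ∂(μ[|D.T ⁻¹' {j}]) := by
    rw [measureReal_def, Discretization.avgKernel, Kernel.comp_apply' _ _ _ hA,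
      D.cellKernel_apply, if_pos ⟨pos_iff_ne_zero.2 hz, hfin⟩,
      integral_eq_lintegral_of_nonneg_ae (.of_forall fun x => measureReal_nonneg)
        (measurable_kernel_real hA).aestronglyMeasurable]
    congr 1
    exact lintegral_congr fun x => (ofReal_measureReal).symm
  rw [hreal, ProbabilityTheory.cond, integral_smul_measure, smul_eq_mul, ← mul_assoc,
    measureReal_def, ENNReal.toReal_inv, mul_inv_cancel₀, one_mul]
  exact (ENNReal.toReal_pos hz hfin.ne).ne'

/-- If `f` is close in `L¹(μ)` to a function that is constant on cells, then averaging the kernel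
over cells hardly changes its integral against `f`. -/
lemma Discretization.abs_kernelIntegral_sub_le {Z : Type*} [MeasurableSpace Z] {α : ℝ} (x₀ : S)
    {Q : Kernel S Z} [IsMarkovKernel Q] (hQ : IsPrivateKernel α Q) {f : S → ℝ}
    (hf : Integrable f μ) {v : Fin D.k → ℝ} (hv : Integrable (fun x => v (D.T x)) μ) {δ : ℝ}
    (hδ : ∫ x, |f x - v (D.T x)| ∂μ ≤ δ) {A : Set Z} (hA : MeasurableSet A) :
    |kernelIntegral ((D.avgKernel μ x₀ Q).comap D.T D.measurable_T) μ f A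
      - kernelIntegral Q μ f A| ≤ 2 * Real.exp α * δ * (Q x₀).real A := by
  set Q' := (D.avgKernel μ x₀ Q).comap D.T D.measurable_T
  have hc' : IsComparable (Real.exp α) Q' (Q x₀) := fun x A hA =>
    hQ.isComparable_comp (η := D.cellKernel μ x₀) x₀ (D.T x) A hA
  have hc := hQ.isComparable x₀
  have e : kernelIntegral Q' μ f A - kernelIntegral Q μ f A
      = kernelIntegral Q' μ (fun x => f x - v (D.T x)) A
        - kernelIntegral Q μ (fun x => f x - v (D.T x)) A := by
    rw [kernelIntegral_sub hf hv hA, kernelIntegral_sub hf hv hA,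
      D.kernelIntegral_comap_avgKernel x₀ Q hv hA]
    ring
  rw [e]
  have b : ∀ Q₁ : Kernel S Z, IsMarkovKernel Q₁ → IsComparable (Real.exp α) Q₁ (Q x₀) →
      |kernelIntegral Q₁ μ (fun x => f x - v (D.T x)) A| ≤ Real.exp α * δ * (Q x₀).real A :=
    fun Q₁ _ h₁ => (h₁.abs_kernelIntegral_le (hf.sub hv) hA).trans (by
      gcongr
      exact hδ)
  refine (abs_sub _ _).trans ?_
  have := b Q' inferInstance hc'
  have := b Q inferInstance hc
  linarith

end Cells

lemma exists_discretization_of_integrable {S : Type*} [MeasurableSpace S] {μ : Measure S}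
    {f₁ f₂ : S → ℝ} (h₁ : Integrable f₁ μ) (h₂ : Integrable f₂ μ) {δ : ℝ} (hδ : 0 < δ) :
    ∃ D : Discretization S, ∃ v₁ v₂ : Fin D.k → ℝ,
      Integrable (fun x => v₁ (D.T x)) μ ∧ Integrable (fun x => v₂ (D.T x)) μ ∧
      ∫ x, |f₁ x - v₁ (D.T x)| ∂μ ≤ δ ∧ ∫ x, |f₂ x - v₂ (D.T x)| ∂μ ≤ δ := by
  have hδ' : ENNReal.ofReal δ ≠ 0 := by simpa using hδ
  obtain ⟨φ₁, hφ₁, hm₁⟩ := (memLp_one_iff_integrable.2 h₁).exists_simpleFunc_eLpNorm_sub_lt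
    ENNReal.one_ne_top hδ'
  obtain ⟨φ₂, hφ₂, hm₂⟩ := (memLp_one_iff_integrable.2 h₂).exists_simpleFunc_eLpNorm_sub_lt
    ENNReal.one_ne_top hδ'
  have hi₁ := memLp_one_iff_integrable.1 hm₁
  have hi₂ := memLp_one_iff_integrable.1 hm₂
  -- the cells are the joint level sets of the two approximating simple functions
  set ψ := φ₁.pair φ₂
  let T : S → Fin ψ.range.card := fun x => ψ.range.equivFin ⟨ψ x, ψ.mem_range_self x⟩
  have hT : ∀ x, (ψ.range.equivFin.symm (T x)).1 = ψ x := fun x => by simp [T]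
  have hmeas : Measurable T := by
    refine measurable_to_countable' fun j => ?_
    have : T ⁻¹' {j} = ψ ⁻¹' {(ψ.range.equivFin.symm j).1} := by
      ext x
      simp only [Set.mem_preimage, Set.mem_singleton_iff]
      rw [← hT x, Subtype.ext_iff.symm, Equiv.apply_eq_iff_eq]
    rw [this]
    exact ψ.measurableSet_fiber _
  refine ⟨⟨_, T, hmeas⟩, fun j => (ψ.range.equivFin.symm j).1.1,
    fun j => (ψ.range.equivFin.symm j).1.2, ?_, ?_, ?_, ?_⟩
  · simp only [hT]; exact hi₁
  · simp only [hT]; exact hi₂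
  · simp only [hT]
    exact integral_abs_le_of_eLpNorm_le (h₁.sub hi₁).aestronglyMeasurable hδ.le hφ₁.le
  · simp only [hT]
    exact integral_abs_le_of_eLpNorm_le (h₂.sub hi₂).aestronglyMeasurable hδ.le hφ₂.le

/-- Discretizations exist at every error level: take the joint level sets of simple functions that
approximate `p_θ` and `s_θ p_θ` in `L¹(μ)`. -/
theorem IsDQMScore.exists_isApprox {S : Type*} [MeasurableSpace S] {Θ : Set ℝ}
    {P : ℝ → Measure S} {μ : Measure S} {θ : ℝ} {s : S → ℝ} (H : IsDQMScore Θ P μ θ s)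
    (hP : ∀ t ∈ Θ, IsProbabilityMeasure (P t)) (α : ℝ) {e : ℝ} (he : 0 < e) :
    ∃ D : Discretization S, Discretization.IsApprox.{u} D α Θ P μ e θ := by
  have := hP θ H.mem
  set K := ∫ x, |s x * modelDensity P μ θ x| ∂μ
  set c := Real.exp α
  have hc : 0 < c := Real.exp_pos α
  set M := 2 * (c * K) / c⁻¹ + (c * K) ^ 2 / c⁻¹ ^ 2
  have hK : 0 ≤ K := integral_nonneg fun x => abs_nonneg _
  have hM : 0 ≤ M := by positivity
  set δ := e / (2 * c * (M + 1))
  have hδ : 0 < δ := by positivity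
  have hδM : 2 * c * δ * M ≤ e := by
    have : 2 * c * δ * M = e * (M / (M + 1)) := by simp only [δ]; field_simp
    rw [this]
    exact mul_le_of_le_one_right he.le ((div_le_one (by positivity)).2 (by linarith))
  obtain ⟨D, v₁, v₂, hv₁, hv₂, h₁, h₂⟩ := exists_discretization_of_integrable
    (H.integrable_mul hP) (integrable_modelDensity P μ θ) hδ
  refine ⟨D, fun Z _ Q _ hQ x₀ => ⟨inferInstance, hQ.comp, ?_⟩⟩
  simp_rw [← Kernel.comap_comp_measure (D.avgKernel μ x₀ Q) D.measurable_T]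
  have hc' : IsComparable c ((D.avgKernel μ x₀ Q).comap D.T D.measurable_T) (Q x₀) :=
    fun x A hA => hQ.isComparable_comp (η := D.cellKernel μ x₀) x₀ (D.T x) A hA
  refine (hc'.abs_fisherInfo_sub_le (hQ.isComparable x₀) hc H H hP le_rfl le_rfl
    (fun A hA => D.abs_kernelIntegral_sub_le x₀ hQ (H.integrable_mul hP) hv₁ h₁ hA)
    (fun A hA => D.abs_kernelIntegral_sub_le x₀ hQ (integrable_modelDensity P μ θ) hv₂ h₂
      hA)).trans (hδM.trans ?_)
  exact le_mul_of_one_le_left he.le (le_max_right _ _)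

/-! ### Replacing a mixture by one with few atoms -/

/-- In finite dimension the convex hull of a compact set is compact, by Carathéodory's theorem. -/
lemma IsCompact.convexHull_of_finiteDimensional {E : Type*} [NormedAddCommGroup E]
    [NormedSpace ℝ E] [FiniteDimensional ℝ E] {s : Set E} (hs : IsCompact s) :
    IsCompact (convexHull ℝ s) := by
  let F : (m : ℕ) → (Fin m → ℝ) × (Fin m → E) → E := fun m x => ∑ i, x.1 i • x.2 i
  have hF : ∀ m, Continuous (F m) := fun m => by fun_prop
  have heq : convexHull ℝ s = ⋃ m ∈ Finset.range (Module.finrank ℝ E + 2),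
      F m '' (stdSimplex ℝ (Fin m) ×ˢ Set.univ.pi fun _ => s) := by
    refine Set.Subset.antisymm (fun x hx => ?_) (Set.iUnion₂_subset fun m _ => ?_)
    · obtain ⟨ι, _, z, w, hz, hind, hw, hw1, rfl⟩ := eq_pos_convex_span_of_mem_convexHull hx
      have hcard : Fintype.card ι < Module.finrank ℝ E + 2 := by
        have h1 := hind.card_le_finrank_succ
        have h2 := Submodule.finrank_le (vectorSpan ℝ (Set.range z))
        omega
      simp only [Set.mem_iUnion]
      refine ⟨Fintype.card ι, Finset.mem_range.2 hcard,
        (fun i => w ((Fintype.equivFin ι).symm i), fun i => z ((Fintype.equivFin ι).symm i)),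
        ⟨⟨fun i => (hw _).le, ?_⟩, fun i _ => hz ⟨_, rfl⟩⟩, ?_⟩
      · rw [← hw1]; exact Equiv.sum_comp (Fintype.equivFin ι).symm w
      · exact Equiv.sum_comp (Fintype.equivFin ι).symm fun i => w i • z i
    · rintro _ ⟨⟨w, z⟩, ⟨hw, hz⟩, rfl⟩
      exact (convex_convexHull ℝ s).sum_mem (fun i _ => hw.1 i) hw.2
        fun i _ => subset_convexHull ℝ s (hz i trivial)
  rw [heq]
  refine Finset.isCompact_biUnion _ fun m _ => ?_
  exact ((isCompact_stdSimplex ℝ (Fin m)).prod (isCompact_univ_pi fun _ => hs)).image (hF m)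

/-- A linear program with `k` equality constraints has a solution with at most `k` atoms: a linear
relation between the `v i` can be added to or subtracted from the weights without decreasing the
objective `r`, until some weight vanishes. -/
lemma exists_weights_card_le {ι : Type*} {k : ℕ} (v : ι → Fin k → ℝ) (j₀ : Fin k)
    (hv : ∀ i, v i j₀ = 1) (r : ι → ℝ) (s : Finset ι) (w : ι → ℝ) (hw : ∀ i ∈ s, 0 ≤ w i) :
    ∃ t : Finset ι, ∃ w' : ι → ℝ, t.card ≤ k ∧ (∀ i ∈ t, 0 ≤ w' i) ∧
      ∑ i ∈ t, w' i • v i = ∑ i ∈ s, w i • v i ∧ ∑ i ∈ s, w i * r i ≤ ∑ i ∈ t, w' i * r i := by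
  classical
  induction s using Finset.strongInduction generalizing w with
  | H s ih =>
  by_cases hs : s.card ≤ k
  · exact ⟨s, w, hs, hw, rfl, le_rfl⟩
  have hdep : ¬ LinearIndepOn ℝ v (s : Set ι) := fun h => by
    have := LinearIndependent.fintype_card_le_finrank h
    simp at this
    omega
  obtain ⟨c₀, hc₀, i₀, hi₀, hne₀⟩ := not_linearIndepOn_finset_iff.1 hdep
  obtain ⟨c, hc, hne, hcr⟩ : ∃ c : ι → ℝ, ∑ i ∈ s, c i • v i = 0 ∧ c i₀ ≠ 0 ∧
      0 ≤ ∑ i ∈ s, c i * r i := by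
    rcases le_total 0 (∑ i ∈ s, c₀ i * r i) with h | h
    · exact ⟨c₀, hc₀, hne₀, h⟩
    · refine ⟨fun i => -c₀ i, ?_, neg_ne_zero.2 hne₀, ?_⟩
      · simp only [neg_smul, Finset.sum_neg_distrib, hc₀, neg_zero]
      · simp only [neg_mul, Finset.sum_neg_distrib]; linarith
  have hc1 : ∑ i ∈ s, c i = 0 := by
    have := congrFun hc j₀
    simpa [Finset.sum_apply, hv] using this
  obtain ⟨i₁, hi₁, hneg₁⟩ : ∃ i ∈ s, c i < 0 := by
    by_contra! hcon
    exact hne ((Finset.sum_eq_zero_iff_of_nonneg hcon).1 hc1 i₀ hi₀)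
  obtain ⟨m, hm, hmin⟩ := (s.filter fun i => c i < 0).exists_min_image (fun i => w i / -c i)
    ⟨i₁, Finset.mem_filter.2 ⟨hi₁, hneg₁⟩⟩
  obtain ⟨hms, hmneg⟩ := Finset.mem_filter.1 hm
  set τ := w m / -c m
  have hτ : 0 ≤ τ := div_nonneg (hw m hms) (by linarith)
  have hzero : w m + τ * c m = 0 := by
    have hne' : c m ≠ 0 := hmneg.ne
    simp only [τ]
    field_simp
    ring
  have hnn : ∀ i ∈ s, 0 ≤ w i + τ * c i := fun i hi => by
    rcases lt_or_ge (c i) 0 with h | h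
    · have := hmin i (Finset.mem_filter.2 ⟨hi, h⟩)
      rw [le_div_iff₀ (by linarith)] at this
      linarith
    · have := hw i hi
      positivity
  obtain ⟨t, w', ht, hw', h1, h2⟩ := ih (s.erase m) (Finset.erase_ssubset hms)
    (fun i => w i + τ * c i) fun i hi => hnn i (Finset.mem_of_mem_erase hi)
  refine ⟨t, w', ht, hw', h1.trans ?_, le_trans ?_ h2⟩
  · rw [Finset.sum_erase _ (by simp [hzero])]
    simp only [add_smul, Finset.sum_add_distrib, mul_smul, ← Finset.smul_sum, hc, smul_zero,
      add_zero]
  · rw [Finset.sum_erase _ (by simp [hzero])]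
    simp only [add_mul, Finset.sum_add_distrib, mul_assoc, ← Finset.mul_sum]
    have := mul_nonneg hτ hcr
    linarith

/-- The integral of `φ ∘ q`, for `q` with values in a compact set of `ℝᵏ`, is dominated by that of a
`k`-atomic measure on the same compact set with the same total mass and barycentre. -/
theorem exists_atoms_integral_le {Z : Type*} [MeasurableSpace Z] {ν : Measure Z}
    [IsProbabilityMeasure ν] {k : ℕ} {B : Set (Fin k → ℝ)} (hB : IsCompact B) {j₀ : Fin k}
    (hB1 : ∀ v ∈ B, v j₀ = 1) {φ : (Fin k → ℝ) → ℝ} (hφ : ContinuousOn φ B) {q : Z → Fin k → ℝ}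
    (hq : Integrable q ν) (hqφ : Integrable (fun z => φ (q z)) ν) (hqB : ∀ᵐ z ∂ν, q z ∈ B) :
    ∃ w : Fin k → ℝ, ∃ v : Fin k → Fin k → ℝ, (∀ i, 0 ≤ w i) ∧ (∀ i, v i ∈ B) ∧
      ∑ i, w i • v i = ∫ z, q z ∂ν ∧ ∫ z, φ (q z) ∂ν ≤ ∑ i, w i * φ (v i) := by
  set graph : Set ((Fin k → ℝ) × ℝ) := (fun v => (v, φ v)) '' B
  have hgraph : IsCompact graph := hB.image_of_continuousOn (continuousOn_id.prodMk hφ)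
  have hmem := (convex_convexHull ℝ graph).integral_mem (μ := ν) (f := fun z => (q z, φ (q z)))
    hgraph.convexHull_of_finiteDimensional.isClosed
    (hqB.mono fun z hz => subset_convexHull ℝ _ ⟨q z, hz, rfl⟩) (hq.prodMk hqφ)
  rw [integral_pair hq hqφ] at hmem
  obtain ⟨ι, _, w, y, hw, -, hy, hsum⟩ := mem_convexHull_iff_exists_fintype.1 hmem
  choose v hvB hvy using hy
  have hs1 : ∑ i, w i • v i = ∫ z, q z ∂ν := by
    have e := congrArg Prod.fst hsum
    rw [Prod.fst_sum] at e
    refine Eq.trans ?_ e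
    exact Finset.sum_congr rfl fun i _ => by rw [← hvy]; rfl
  have hs2 : ∑ i, w i * φ (v i) = ∫ z, φ (q z) ∂ν := by
    have e := congrArg Prod.snd hsum
    rw [Prod.snd_sum] at e
    refine Eq.trans ?_ e
    exact Finset.sum_congr rfl fun i _ => by rw [← hvy]; rfl
  obtain ⟨t, w', ht, hw', h1, h2⟩ := exists_weights_card_le v j₀ (fun i => hB1 _ (hvB i))
    (fun i => φ (v i)) Finset.univ w fun i _ => hw i
  obtain ⟨z₀, hz₀⟩ := hqB.exists
  obtain ⟨f⟩ : Nonempty (t ↪ Fin k) := Function.Embedding.nonempty_of_card_le (by simpa using ht)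
  refine ⟨Function.extend f (fun i => w' i) 0, Function.extend f (fun i => v i) fun _ => q z₀,
    fun i => ?_, fun i => ?_, ?_, ?_⟩
  · by_cases hi : ∃ a, f a = i
    · obtain ⟨a, rfl⟩ := hi
      rw [f.injective.extend_apply]
      exact hw' _ a.2
    · rw [Function.extend_apply' _ _ _ hi]; rfl
  · by_cases hi : ∃ a, f a = i
    · obtain ⟨a, rfl⟩ := hi
      rw [f.injective.extend_apply]
      exact hvB _
    · rw [Function.extend_apply' _ _ _ hi]; exact hz₀
  · rw [← hs1, ← h1, ← Finset.sum_coe_sort t]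
    refine (Fintype.sum_of_injective f f.injective _ _ (fun i hi => ?_) fun a => ?_).symm
    · rw [Function.extend_apply' _ _ _ hi]; simp
    · rw [f.injective.extend_apply, f.injective.extend_apply]
  · rw [← hs2]
    refine h2.trans (le_of_eq ?_)
    rw [← Finset.sum_coe_sort t]
    refine Fintype.sum_of_injective f f.injective _ _ (fun i hi => ?_) fun a => ?_
    · rw [Function.extend_apply' _ _ _ hi]; simp
    · rw [f.injective.extend_apply, f.injective.extend_apply]

/-! ### Finite private channels -/

section MatrixKernel

variable {l k : ℕ} {M : Matrix (Fin l) (Fin k) ℝ} {α : ℝ}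

lemma matrixKernel_apply (M : Matrix (Fin l) (Fin k) ℝ) (j : Fin k) :
    matrixKernel M j = ∑ i, ENNReal.ofReal (M i j) • Measure.dirac i := rfl

instance (M : Matrix (Fin l) (Fin k) ℝ) (j : Fin k) : IsFiniteMeasure (matrixKernel M j) := by
  refine ⟨?_⟩
  rw [matrixKernel_apply, Measure.finsetSum_apply]
  simp [ENNReal.sum_lt_top]

lemma integral_matrixKernel {j : Fin k} (hM : ∀ i, 0 ≤ M i j) (f : Fin l → ℝ) :
    ∫ i, f i ∂(matrixKernel M j) = ∑ i, M i j * f i := by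
  rw [matrixKernel_apply, integral_finsetSum_measure fun i _ =>
    (integrable_dirac (by simp)).smul_measure ENNReal.ofReal_ne_top]
  refine Finset.sum_congr rfl fun i _ => ?_
  rw [integral_smul_measure, integral_dirac, ENNReal.toReal_ofReal (hM i), smul_eq_mul]

lemma measureReal_matrixKernel {j : Fin k} (hM : ∀ i, 0 ≤ M i j) (A : Set (Fin l)) :
    (matrixKernel M j).real A = ∑ i, M i j * A.indicator 1 i := by
  rw [← integral_matrixKernel hM, integral_indicator_one (Set.toFinite A).measurableSet]

lemma isMarkovKernel_matrixKernel (hM : M ∈ privateMatrices α l k) :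
    IsMarkovKernel (matrixKernel M) := by
  refine ⟨fun j => ⟨?_⟩⟩
  have h := measureReal_matrixKernel (fun i => hM.1 i j) Set.univ
  simp only [Set.indicator_univ, Pi.one_apply, mul_one, hM.2.1 j, measureReal_def] at h
  rwa [ENNReal.toReal_eq_one_iff] at h

lemma isPrivateKernel_matrixKernel (hM : M ∈ privateMatrices α l k) :
    IsPrivateKernel α (matrixKernel M) := by
  intro A _ j j'
  rw [← ofReal_measureReal, ← ofReal_measureReal, ← ENNReal.ofReal_mul (Real.exp_pos _).le,
    measureReal_matrixKernel fun i => hM.1 i j, measureReal_matrixKernel fun i => hM.1 i j',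
    Finset.mul_sum]
  refine ENNReal.ofReal_le_ofReal (Finset.sum_le_sum fun i _ => ?_)
  rw [← mul_assoc]
  exact mul_le_mul_of_nonneg_right (hM.2.2 i j j').2 (Set.indicator_nonneg (by simp) i)

end MatrixKernel

section FiniteInput

variable {S Z : Type*} [MeasurableSpace S] [MeasurableSpace Z] {μ : Measure S} {ν : Measure Z}
  {D : Discretization S} {Q : Kernel (Fin D.k) Z} [IsMarkovKernel Q] {c : ℝ}
  {Θ : Set ℝ} {P : ℝ → Measure S} {θ : ℝ} {s : S → ℝ}

lemma IsComparable.comap {R S' Z' : Type*} [MeasurableSpace R] [MeasurableSpace S']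
    [MeasurableSpace Z'] {κ : Kernel S' Z'} {m : Measure Z'} (h : IsComparable c κ m) {T : R → S'}
    (hT : Measurable T) : IsComparable c (κ.comap T hT) m := fun x A hA => h (T x) A hA

lemma kernelIntegral_comap {f : S → ℝ} (hf : Integrable f μ) {A : Set Z} (hA : MeasurableSet A) :
    kernelIntegral (Q.comap D.T D.measurable_T) μ f A
      = ∑ j, (∫ x in D.T ⁻¹' {j}, f x ∂μ) * (Q j).real A := by
  have hi := integrable_kernel_mul (Q := Q.comap D.T D.measurable_T) hf hA
  have hU : (⋃ j, D.T ⁻¹' {j}) = Set.univ := by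
    rw [← Set.preimage_iUnion, Set.iUnion_of_singleton, Set.preimage_univ]
  rw [kernelIntegral, ← setIntegral_univ, ← hU,
    integral_iUnion_fintype D.measurableSet_cell (fun i j hij =>
      Disjoint.preimage _ (by simpa using hij)) fun j => hi.integrableOn]
  refine Finset.sum_congr rfl fun j _ => ?_
  rw [mul_comm, ← integral_const_mul]
  exact setIntegral_congr_fun (D.measurableSet_cell j) fun x hx => by
    rw [← show D.T x = j from hx]; rfl

lemma isSetDensity_kernelIntegral_comap {f : S → ℝ} (hf : Integrable f μ) {q : Fin D.k → Z → ℝ}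
    (hq : ∀ j, IsSetDensity ν (fun A => (Q j).real A) (q j)) :
    IsSetDensity ν (kernelIntegral (Q.comap D.T D.measurable_T) μ f)
      fun z => ∑ j, (∫ x in D.T ⁻¹' {j}, f x ∂μ) * q j z where
  measurable := Finset.measurable_fun_sum _ fun j _ => (hq j).measurable.const_mul _
  integrable := integrable_finsetSum _ fun j _ => (hq j).integrable.const_mul _
  setIntegral_eq A hA := by
    rw [integral_finsetSum _ fun j _ => ((hq j).integrable.const_mul _).integrableOn,
      kernelIntegral_comap hf hA]
    exact Finset.sum_congr rfl fun j _ => by rw [integral_const_mul, (hq j).setIntegral_eq A hA]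

/-- The contribution to the Fisher information of an output with densities `v j`, per unit of the
dominating measure. -/
noncomputable def cellInfo (D : Discretization S) (μ : Measure S) (f p : S → ℝ)
    (v : Fin D.k → ℝ) : ℝ :=
  (∑ j, (∫ x in D.T ⁻¹' {j}, f x ∂μ) * v j) ^ 2 / ∑ j, (∫ x in D.T ⁻¹' {j}, p x ∂μ) * v j

lemma fisherInfo_comp_map_eq [IsFiniteMeasure ν] (hQ : IsComparable c Q ν) (hc : 0 < c)
    (H : IsDQMScore Θ P μ θ s) (hP : ∀ t ∈ Θ, IsProbabilityMeasure (P t)) {q : Fin D.k → Z → ℝ}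
    (hq : ∀ j, IsSetDensity ν (fun A => (Q j).real A) (q j)) :
    fisherInfo Θ (fun t => Q ∘ₘ (P t).map D.T) θ
      = ∫ z, cellInfo D μ (fun x => s x * modelDensity P μ θ x) (modelDensity P μ θ)
          (fun j => q j z) ∂ν := by
  have := hP θ H.mem
  simp_rw [← Kernel.comap_comp_measure Q D.measurable_T]
  exact (hQ.comap D.measurable_T).fisherInfo_comp hc H hP
    (isSetDensity_kernelIntegral_comap (H.integrable_mul hP) hq)
    (isSetDensity_kernelIntegral_comap (integrable_modelDensity P μ θ) hq)

/-- Vectors whose entries differ by a factor of at most `c`, normalized at `j₀`. -/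
def ratioBoundedVectors {k : ℕ} (c : ℝ) (j₀ : Fin k) : Set (Fin k → ℝ) :=
  {v | v j₀ = 1 ∧ ∀ i j, v i ≤ c * v j}

lemma mem_Icc_of_mem_ratioBoundedVectors {k : ℕ} (hc : 0 < c) {j₀ : Fin k} {v : Fin k → ℝ}
    (hv : v ∈ ratioBoundedVectors c j₀) (j : Fin k) : v j ∈ Set.Icc c⁻¹ c := by
  have h1 := hv.2 j₀ j
  have h2 := hv.2 j j₀
  rw [hv.1] at h1 h2
  exact ⟨(inv_le_iff_one_le_mul₀' hc).2 h1, by simpa using h2⟩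

lemma isCompact_ratioBoundedVectors {k : ℕ} (hc : 0 < c) (j₀ : Fin k) :
    IsCompact (ratioBoundedVectors c j₀) := by
  refine (isCompact_univ_pi fun _ : Fin k => isCompact_Icc (a := c⁻¹) (b := c)).of_isClosed_subset
    ?_ fun v hv j _ => mem_Icc_of_mem_ratioBoundedVectors hc hv j
  have : ratioBoundedVectors c j₀
      = {v | v j₀ = 1} ∩ ⋂ i, ⋂ j, {v : Fin k → ℝ | v i ≤ c * v j} := by
    ext v; simp [ratioBoundedVectors]
  rw [this]
  exact (isClosed_eq (continuous_apply _) continuous_const).inter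
    (isClosed_iInter fun i => isClosed_iInter fun j =>
      isClosed_le (continuous_apply _) (continuous_const.mul (continuous_apply _)))

lemma continuousOn_cellInfo (H : IsDQMScore Θ P μ θ s) (hP : ∀ t ∈ Θ, IsProbabilityMeasure (P t))
    (hc : 0 < c) (j₀ : Fin D.k) (f : S → ℝ) :
    ContinuousOn (cellInfo D μ f (modelDensity P μ θ)) (ratioBoundedVectors c j₀) := by
  have hP' := hP θ H.mem
  refine ContinuousOn.div (by fun_prop) (by fun_prop) fun v hv => ne_of_gt ?_
  have hsum : ∑ j, ∫ x in D.T ⁻¹' {j}, modelDensity P μ θ x ∂μ = 1 := by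
    rw [← integral_iUnion_fintype D.measurableSet_cell (fun i j hij =>
        Disjoint.preimage _ (by simpa using hij))
        fun j => (integrable_modelDensity P μ θ).integrableOn,
      ← Set.preimage_iUnion, Set.iUnion_of_singleton, Set.preimage_univ, setIntegral_univ,
      H.integral_modelDensity H.mem]
  calc 0 < c⁻¹ := inv_pos.2 hc
    _ = ∑ j, (∫ x in D.T ⁻¹' {j}, modelDensity P μ θ x ∂μ) * c⁻¹ := by
      rw [← Finset.sum_mul, hsum, one_mul]
    _ ≤ _ := Finset.sum_le_sum fun j _ => mul_le_mul_of_nonneg_left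
      (mem_Icc_of_mem_ratioBoundedVectors hc hv j).1
      (integral_nonneg fun x => modelDensity_nonneg P μ θ x)

/-- Square matrices suffice: the Fisher information of any private channel with `k` inputs is
dominated by that of a private `k × k` matrix. The information is an integral of `cellInfo` over
the vectors of densities, which are compared with a `k`-atomic measure. -/
theorem exists_privateMatrix_fisherInfo_le {α : ℝ} (hQ : IsPrivateKernel α Q)
    (H : IsDQMScore Θ P μ θ s) (hP : ∀ t ∈ Θ, IsProbabilityMeasure (P t)) :
    ∃ M ∈ privateMatrices α D.k D.k,
      fisherInfo Θ (fun t => Q ∘ₘ (P t).map D.T) θ ≤ discreteFisherInfo Θ P D M θ := by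
  have hPθ := hP θ H.mem
  obtain ⟨x⟩ := nonempty_of_isProbabilityMeasure (P θ)
  set j₀ : Fin D.k := D.T x
  set c := Real.exp α
  have hc : 0 < c := Real.exp_pos α
  set ν := Q j₀
  have hcomp : IsComparable c Q ν := hQ.isComparable j₀
  have hac : ∀ j, Q j ≪ ν := fun j => Measure.AbsolutelyContinuous.mk fun A hA h0 => by
    have := hQ A hA j j₀
    rwa [show Q j₀ A = 0 from h0, mul_zero, nonpos_iff_eq_zero] at this
  set q : Fin D.k → Z → ℝ := fun j z => ((Q j).rnDeriv ν z).toReal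
  have hq : ∀ j, IsSetDensity ν (fun A => (Q j).real A) (q j) := fun j =>
    ⟨(Measure.measurable_rnDeriv _ _).ennreal_toReal, Measure.integrable_toReal_rnDeriv,
      fun A _ => Measure.setIntegral_toReal_rnDeriv (hac j) A⟩
  set φ := cellInfo D μ (fun x => s x * modelDensity P μ θ x) (modelDensity P μ θ)
  set B := ratioBoundedVectors c j₀
  have hφ : ContinuousOn φ B := continuousOn_cellInfo H hP hc j₀ _
  have hBc : IsCompact B := isCompact_ratioBoundedVectors hc j₀
  have hqB : ∀ᵐ z ∂ν, (fun j => q j z) ∈ B := by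
    have hone : IsSetDensity ν (fun A => (Q j₀).real A) fun _ => (1 : ℝ) :=
      ⟨measurable_const, integrable_const 1, fun A _ => by simp [ν]⟩
    have h2 : ∀ᵐ z ∂ν, ∀ i j, q i z ≤ c * q j z := by
      refine ae_all_iff.2 fun i => ae_all_iff.2 fun j => ?_
      filter_upwards [((hq i).sub ((hq j).const_mul c)).ae_le (b := 0) fun A hA => by
        have := (hQ.isComparable j i A hA).1
        simpa using this] with z hz
      linarith
    filter_upwards [(hq j₀).ae_eq hone, h2] with z h1 h3
    exact ⟨h1, h3⟩
  have hqm : Measurable fun z j => q j z := measurable_pi_lambda _ fun j => (hq j).measurable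
  have hφm : Measurable φ := by
    have : ∀ a : Fin D.k → ℝ, Measurable fun v : Fin D.k → ℝ => ∑ j, a j * v j := fun a =>
      Continuous.measurable (by fun_prop)
    exact ((this _).pow_const 2).div (this _)
  have hqi : Integrable (fun z j => q j z) ν := Integrable.of_eval fun j => (hq j).integrable
  have hqφ : Integrable (fun z => φ fun j => q j z) ν := by
    obtain ⟨b, hb⟩ := hBc.exists_bound_of_continuousOn hφ
    exact Integrable.of_bound (hφm.comp hqm).aestronglyMeasurable b (hqB.mono fun z hz => hb _ hz)
  obtain ⟨w, v, hw, hv, h1, h2⟩ := exists_atoms_integral_le hBc (j₀ := j₀) (fun v hv => hv.1) hφ hqi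
    hqφ hqB
  have hv0 : ∀ i j, 0 ≤ v i j := fun i j =>
    (inv_pos.2 hc).le.trans (mem_Icc_of_mem_ratioBoundedVectors hc (hv i) j).1
  set M : Matrix (Fin D.k) (Fin D.k) ℝ := fun i j => w i * v i j
  have hM : M ∈ privateMatrices α D.k D.k := by
    refine ⟨fun i j => mul_nonneg (hw i) (hv0 i j), fun j => ?_, fun i j j' => ⟨?_, ?_⟩⟩
    · have e1 := congrFun h1 j
      rw [eval_integral fun j => (hq j).integrable, ← setIntegral_univ,
        (hq j).setIntegral_eq _ MeasurableSet.univ] at e1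
      simpa [Finset.sum_apply] using e1
    · rw [Real.exp_neg, inv_mul_le_iff₀ (Real.exp_pos _)]
      calc w i * v i j' ≤ w i * (c * v i j) := mul_le_mul_of_nonneg_left ((hv i).2 j' j) (hw i)
        _ = _ := by ring
    · calc w i * v i j ≤ w i * (c * v i j') := mul_le_mul_of_nonneg_left ((hv i).2 j j') (hw i)
        _ = _ := by ring
  refine ⟨M, hM, ?_⟩
  have hMM := isMarkovKernel_matrixKernel hM
  have hM0 : ∀ j i, 0 ≤ M i j := fun j i => hM.1 i j
  have hdens : ∀ j, IsSetDensity (matrixKernel M j₀) (fun A => (matrixKernel M j).real A)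
      (fun i => v i j) := fun j => by
    refine ⟨measurable_of_finite _, Integrable.of_finite, fun A hA => ?_⟩
    rw [← integral_indicator hA, integral_matrixKernel (hM0 j₀), measureReal_matrixKernel (hM0 j)]
    refine Finset.sum_congr rfl fun i _ => ?_
    by_cases hi : i ∈ A
    · simp [hi, M, (hv i).1]
    · simp [hi]
  rw [fisherInfo_comp_map_eq hcomp hc H hP hq, discreteFisherInfo,
    fisherInfo_comp_map_eq ((isPrivateKernel_matrixKernel hM).isComparable j₀) hc H hP hdens,
    integral_matrixKernel (hM0 j₀)]
  refine h2.trans (le_of_eq (Finset.sum_congr rfl fun i _ => ?_))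
  simp [M, (hv i).1, φ]

end FiniteInput

/-! ### Invariance under relabelling of the observation space -/

section Relabel

variable {S Z Z' : Type*} [MeasurableSpace S] [MeasurableSpace Z] [MeasurableSpace Z']
  {Q : Kernel S Z} {α : ℝ} {e : Z → Z'}

lemma IsPrivateKernel.map (hQ : IsPrivateKernel α Q) (he : Measurable e) :
    IsPrivateKernel α (Q.map e) := by
  intro A hA x x'
  rw [Kernel.map_apply' _ he _ hA, Kernel.map_apply' _ he _ hA]
  exact hQ _ (he hA) x x'

lemma IsSetDensity.map_equiv {ν : Measure Z} {D : Set Z → ℝ} {g : Z → ℝ}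
    (h : IsSetDensity ν D g) (e : Z ≃ᵐ Z') :
    IsSetDensity (ν.map e) (fun A => D (e ⁻¹' A)) (g ∘ e.symm) where
  measurable := h.measurable.comp e.symm.measurable
  integrable := by
    rw [integrable_map_equiv]
    simpa [Function.comp_def] using h.integrable
  setIntegral_eq A hA := by
    rw [setIntegral_map_equiv, ← h.setIntegral_eq _ (e.measurable hA)]
    simp

lemma fisherInfo_map_equiv [IsMarkovKernel Q] (hQ : IsPrivateKernel α Q) (e : Z ≃ᵐ Z')
    {μ : Measure S} {Θ : Set ℝ} {P : ℝ → Measure S} {θ : ℝ} {s : S → ℝ}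
    (H : IsDQMScore Θ P μ θ s) (hP : ∀ t ∈ Θ, IsProbabilityMeasure (P t)) :
    fisherInfo Θ (fun t => Q.map e ∘ₘ P t) θ = fisherInfo Θ (fun t => Q ∘ₘ P t) θ := by
  have := hP θ H.mem
  obtain ⟨x₀⟩ := nonempty_of_isProbabilityMeasure (P θ)
  have hmk : IsMarkovKernel (Q.map e) := Kernel.IsMarkovKernel.map Q e.measurable
  have hc := Real.exp_pos α
  have hcomp := hQ.isComparable x₀
  have hcomp' := (hQ.map e.measurable).isComparable x₀
  have hker : ∀ f : S → ℝ, ∀ A, MeasurableSet A →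
      kernelIntegral Q μ f (e ⁻¹' A) = kernelIntegral (Q.map e) μ f A := fun f A hA => by
    simp only [kernelIntegral, measureReal_def, Kernel.map_apply' _ e.measurable _ hA]
  obtain ⟨G, hG⟩ := hcomp.exists_density (H.integrable_mul hP)
  obtain ⟨g, hg⟩ := hcomp.exists_density (integrable_modelDensity P μ θ)
  rw [hcomp.fisherInfo_comp hc H hP hG hg]
  rw [Kernel.map_apply _ e.measurable] at hcomp'
  have := Measure.isProbabilityMeasure_map (μ := Q x₀) e.measurable.aemeasurable
  rw [hcomp'.fisherInfo_comp hc H hP ((hG.map_equiv e).congr (hker _))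
    ((hg.map_equiv e).congr (hker _)), integral_map_equiv]
  simp

end Relabel

/-! ### Convergence of the plug-in information -/

section Plugin

variable {S : Type*} [MeasurableSpace S] {μ : Measure S} {Θ : Set ℝ} {P : ℝ → Measure S}
  {s : ℝ → S → ℝ} {θ : ℝ} {α : ℝ}

/-- The Fisher informations `t ↦ I_t(QP)`, for private `Q`, are equicontinuous. -/
theorem eventually_abs_fisherInfo_sub_le (hP : ∀ t ∈ Θ, IsProbabilityMeasure (P t))
    (H : ∀ t ∈ Θ, IsDQMScore Θ P μ t (s t)) (hθ : θ ∈ Θ)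
    (hs : Tendsto (fun t => ∫ x, |s t x * modelDensity P μ t x - s θ x * modelDensity P μ θ x| ∂μ)
      (𝓝[Θ] θ) (𝓝 0)) (α : ℝ) {δ : ℝ} (hδ : 0 < δ) :
    ∀ᶠ t in 𝓝[Θ] θ, ∀ (Z : Type u) [MeasurableSpace Z] (Q : Kernel S Z), IsMarkovKernel Q →
      IsPrivateKernel α Q →
      |fisherInfo Θ (fun t => Q ∘ₘ P t) t - fisherInfo Θ (fun t => Q ∘ₘ P t) θ| ≤ δ := by
  set K := ∫ x, |s θ x * modelDensity P μ θ x| ∂μ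
  have hK : 0 ≤ K := integral_nonneg fun x => abs_nonneg _
  set c := Real.exp α
  have hc : 0 < c := Real.exp_pos α
  set M := 2 * (c * (K + 1)) / c⁻¹ + (c * (K + 1)) ^ 2 / c⁻¹ ^ 2
  have hM : 0 < M := by positivity
  have hη : 0 < δ / (c * M) := by positivity
  have hp := ((H θ hθ).tendsto_integral_abs_sub hP).mono_left (nhdsWithin_le_nhds (s := Θ))
  filter_upwards [hs.eventually (gt_mem_nhds hη), hs.eventually (gt_mem_nhds one_pos),
    hp.eventually (gt_mem_nhds hη), self_mem_nhdsWithin] with t h1 h2 h3 ht Z _ Q _ hQ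
  have := hP t ht
  have := hP θ hθ
  obtain ⟨x₀⟩ := nonempty_of_isProbabilityMeasure (P θ)
  have hcomp := hQ.isComparable x₀
  have it := (H t ht).integrable_mul hP
  have iθ := (H θ hθ).integrable_mul hP
  have hKt : ∫ x, |s t x * modelDensity P μ t x| ∂μ ≤ K + 1 := by
    calc ∫ x, |s t x * modelDensity P μ t x| ∂μ
        ≤ ∫ x, (|s θ x * modelDensity P μ θ x|
          + |s t x * modelDensity P μ t x - s θ x * modelDensity P μ θ x|) ∂μ := by
          refine integral_mono it.abs (iθ.abs.add (it.sub iθ).abs) fun x => ?_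
          dsimp only
          refine le_trans (le_of_eq ?_) (abs_add_le _ _)
          simp
      _ = K + ∫ x, |s t x * modelDensity P μ t x - s θ x * modelDensity P μ θ x| ∂μ :=
          integral_add iθ.abs (it.sub iθ).abs
      _ ≤ K + 1 := by gcongr
  refine (hcomp.abs_fisherInfo_sub_le hcomp hc (H t ht) (H θ hθ) hP hKt
    (le_add_of_nonneg_right zero_le_one) (δ := c * (δ / (c * M))) (fun A hA => ?_)
    fun A hA => ?_).trans (le_of_eq (by change _ * M = _; field_simp))
  · rw [← kernelIntegral_sub it iθ hA]
    exact (hcomp.abs_kernelIntegral_le (it.sub iθ) hA).trans (mul_le_mul_of_nonneg_right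
      (mul_le_mul_of_nonneg_left h1.le hc.le) measureReal_nonneg)
  · have jt := integrable_modelDensity P μ t
    have jθ := integrable_modelDensity P μ θ
    rw [← kernelIntegral_sub jt jθ hA]
    exact (hcomp.abs_kernelIntegral_le (jt.sub jθ) hA).trans (mul_le_mul_of_nonneg_right
      (mul_le_mul_of_nonneg_left h3.le hc.le) measureReal_nonneg)

lemma bddAbove_privateFisherInfos {s : S → ℝ} (hP : ∀ t ∈ Θ, IsProbabilityMeasure (P t))
    (H : IsDQMScore Θ P μ θ s) (α : ℝ) : BddAbove (privateFisherInfos.{u} α Θ P θ) := by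
  have := hP θ H.mem
  obtain ⟨x₀⟩ := nonempty_of_isProbabilityMeasure (P θ)
  refine ⟨(Real.exp α * ∫ x, |s x * modelDensity P μ θ x| ∂μ) ^ 2 / (Real.exp α)⁻¹, ?_⟩
  rintro r ⟨Z, _, Q, _, hQ, rfl⟩
  exact (hQ.isComparable x₀).fisherInfo_le (Real.exp_pos α) H hP

lemma discreteFisherInfo_eq (D : Discretization S) (M : Matrix (Fin D.k) (Fin D.k) ℝ) (t : ℝ) :
    discreteFisherInfo Θ P D M t
      = fisherInfo Θ (fun t => (matrixKernel M).comap D.T D.measurable_T ∘ₘ P t) t := by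
  simp_rw [Kernel.comap_comp_measure]
  rfl

lemma discreteFisherInfo_mem {s : S → ℝ} (hP : ∀ t ∈ Θ, IsProbabilityMeasure (P t))
    (H : IsDQMScore Θ P μ θ s) (D : Discretization S) {M : Matrix (Fin D.k) (Fin D.k) ℝ}
    (hM : M ∈ privateMatrices α D.k D.k) :
    discreteFisherInfo Θ P D M θ ∈ privateFisherInfos.{u} α Θ P θ := by
  have := isMarkovKernel_matrixKernel hM
  have hpriv : IsPrivateKernel α ((matrixKernel M).comap D.T D.measurable_T) := fun A hA x x' =>
    isPrivateKernel_matrixKernel hM A hA (D.T x) (D.T x')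
  let e : Fin D.k ≃ᵐ ULift.{u} (Fin D.k) := MeasurableEquiv.ulift.symm
  refine ⟨ULift.{u} (Fin D.k), inferInstance,
    ((matrixKernel M).comap D.T D.measurable_T).map e, Kernel.IsMarkovKernel.map _ e.measurable,
    hpriv.map e.measurable, ?_⟩
  rw [discreteFisherInfo_eq, fisherInfo_map_equiv hpriv e H hP]

/-- A maximizer for a discretization at a parameter near `θ` with small error level nearly attains
the optimal private information at `θ`, also when evaluated at another parameter near `θ`. -/
theorem exists_abs_discreteFisherInfo_sub_le (hP : ∀ t ∈ Θ, IsProbabilityMeasure (P t))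
    (H : ∀ t ∈ Θ, IsDQMScore Θ P μ t (s t)) (hθ : θ ∈ Θ)
    (hs : Tendsto (fun t => ∫ x, |s t x * modelDensity P μ t x - s θ x * modelDensity P μ θ x| ∂μ)
      (𝓝[Θ] θ) (𝓝 0)) (hI : ContinuousWithinAt (fun t => fisherInfo Θ P t) Θ θ)
    (α : ℝ) {δ : ℝ} (hδ : 0 < δ) :
    ∃ ρ > 0, ∀ t ∈ Θ, |t - θ| < ρ → ∀ t' ∈ Θ, |t' - θ| < ρ → ∀ e, 0 < e → e < ρ →
      ∀ D : Discretization S, Discretization.IsApprox.{u} D α Θ P μ e t →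
      ∀ M ∈ privateMatrices α D.k D.k,
        IsMaxOn (fun M => discreteFisherInfo Θ P D M t) (privateMatrices α D.k D.k) M →
        |discreteFisherInfo Θ P D M t' - sSup (privateFisherInfos.{u} α Θ P θ)| ≤ δ := by
  have hPθ := hP θ hθ
  obtain ⟨x₀⟩ := nonempty_of_isProbabilityMeasure (P θ)
  set b := max (fisherInfo Θ P θ + 1) 1
  have hb : 0 < b := zero_lt_one.trans_le (le_max_right _ _)
  have hev := ((eventually_abs_fisherInfo_sub_le.{0} hP H hθ hs α (δ := δ / 4) (by linarith)).and
    (eventually_abs_fisherInfo_sub_le.{u} hP H hθ hs α (δ := δ / 4) (by linarith))).and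
    (hI.eventually (gt_mem_nhds (lt_add_one (fisherInfo Θ P θ))))
  obtain ⟨ρ₁, hρ₁, hball⟩ := Metric.mem_nhdsWithin_iff.1 hev
  refine ⟨min ρ₁ (δ / 4 / b), lt_min hρ₁ (by positivity), ?_⟩
  intro t ht htρ t' ht' htρ' e he heρ D hD M hM hmax
  obtain ⟨⟨t1, t2⟩, t3⟩ := hball ⟨by
    rw [Metric.mem_ball, Real.dist_eq]; exact htρ.trans_le (min_le_left _ _), ht⟩
  obtain ⟨⟨t1', -⟩, -⟩ := hball ⟨by
    rw [Metric.mem_ball, Real.dist_eq]; exact htρ'.trans_le (min_le_left _ _), ht'⟩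
  have hbe : max (fisherInfo Θ P t) 1 * e ≤ δ / 4 := by
    calc max (fisherInfo Θ P t) 1 * e ≤ b * (δ / 4 / b) := by
          gcongr
          · exact max_le_max_right _ t3.le
          · exact heρ.le.trans (min_le_right _ _)
      _ = δ / 4 := by field_simp
  have hMk := isMarkovKernel_matrixKernel hM
  have hpriv : IsPrivateKernel α ((matrixKernel M).comap D.T D.measurable_T) := fun A hA x x' =>
    isPrivateKernel_matrixKernel hM A hA (D.T x) (D.T x')
  have a1 := t1 _ _ inferInstance hpriv
  have a2 := t1' _ _ inferInstance hpriv
  rw [← discreteFisherInfo_eq, ← discreteFisherInfo_eq, abs_le] at a1 a2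
  have hmem := discreteFisherInfo_mem.{u} hP (H θ hθ) D hM
  have hbdd := bddAbove_privateFisherInfos.{u} hP (H θ hθ) α
  have hup := le_csSup hbdd hmem
  have hlow : sSup (privateFisherInfos.{u} α Θ P θ) ≤ discreteFisherInfo Θ P D M t' + δ := by
    refine csSup_le ⟨_, hmem⟩ ?_
    rintro r ⟨Z, _, Q, hQm, hQ, rfl⟩
    obtain ⟨-, hav, happ⟩ := hD Z Q hQm hQ x₀
    obtain ⟨M', hM', hle⟩ := exists_privateMatrix_fisherInfo_le hav (H t ht) hP
    have b1 := abs_le.1 (t2 Z Q hQm hQ)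
    have b2 := abs_le.1 happ
    have b3 : discreteFisherInfo Θ P D M' t ≤ discreteFisherInfo Θ P D M t := hmax hM'
    linarith [b1.1, b1.2, b2.1, b2.2, a1.1, a1.2, a2.1, a2.2]
  rw [abs_le]
  constructor <;> linarith [a1.1, a1.2, a2.1, a2.2]

end Plugin

theorem mainTheorem4 {d : ℕ} (X : Set (EuclideanSpace ℝ (Fin d)))
    (α : ℝ) (hα : 0 < α)
    -- the dominated model, with densities `p θ` and scores `s θ`
    (Θ : Set ℝ) (P : ℝ → Measure X) (hP : ∀ θ ∈ Θ, IsProbabilityMeasure (P θ))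
    (μ : Measure X) [SigmaFinite μ] (hμ : ∀ K : Set X, IsCompact K → μ K < ⊤)
    (p : ℝ → X → ℝ) (hp_nonneg : ∀ θ ∈ Θ, ∀ x, 0 ≤ p θ x)
    (hp : ∀ θ ∈ Θ, P θ = μ.withDensity fun x => ENNReal.ofReal (p θ x))
    (s : ℝ → X → ℝ) (hDQM : ∀ θ ∈ Θ, IsDQMScore Θ P μ θ (s θ))
    (hp_cont : ∀ θ ∈ Θ, Continuous (p θ))
    (hsp_cont : ∀ θ ∈ Θ, Continuous fun x => s θ x * p θ x)
    -- continuity in the parameter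
    (hsp_L1 : ∀ θ ∈ Θ, Tendsto
      (fun t => eLpNorm (fun x => s t x * p t x - s θ x * p θ x) 1 μ) (𝓝[Θ] θ) (𝓝 0))
    (hI_cont : ContinuousOn (fun θ => fisherInfo Θ P θ) Θ)
    -- the consistent preliminary estimator and the null sequence of error levels
    {Ω : Type*} [MeasurableSpace Ω] (Pr : Measure Ω) [IsProbabilityMeasure Pr]
    (θ₀ : ℝ) (hθ₀ : θ₀ ∈ Θ)
    (θhat : ℕ → Ω → ℝ) (hθhat_meas : ∀ n, Measurable (θhat n)) (hθhat_mem : ∀ n ω, θhat n ω ∈ Θ)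
    (hθhat : TendstoInMeasure Pr θhat atTop fun _ => θ₀)
    (ε : ℕ → ℝ) (hε_pos : ∀ n, 0 < ε n) (hε : Tendsto ε atTop (𝓝 0)) :
    -- discretization maps exist at every error level and every parameter
    (∀ e > 0, ∀ θ ∈ Θ, ∃ D : Discretization X,
      Discretization.IsApprox.{u} D α Θ P μ e θ) ∧
    -- the supremum of the private Fisher informations is finite
    BddAbove (privateFisherInfos.{u} α Θ P θ₀) ∧
    -- and it is the limit in probability, for all discretization maps and all maximizers
    ∀ T : ℝ → ℝ → Discretization X,
      (∀ e > 0, ∀ θ ∈ Θ, Discretization.IsApprox.{u} (T e θ) α Θ P μ e θ) →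
      ∀ Qhat : (n : ℕ) → (ω : Ω) →
          Matrix (Fin (T (ε n) (θhat n ω)).k) (Fin (T (ε n) (θhat n ω)).k) ℝ,
        (∀ n ω, Qhat n ω ∈ privateMatrices α _ _ ∧
          IsMaxOn (fun M => discreteFisherInfo Θ P (T (ε n) (θhat n ω)) M (θhat n ω))
            (privateMatrices α _ _) (Qhat n ω)) →
        ∀ θseq : ℕ → ℝ, (∀ n, θseq n ∈ Θ) → Tendsto θseq atTop (𝓝 θ₀) →
          TendstoInMeasure Pr
            (fun n ω => discreteFisherInfo Θ P (T (ε n) (θhat n ω)) (Qhat n ω) (θseq n))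
            atTop (fun _ => sSup (privateFisherInfos.{u} α Θ P θ₀)) := by
  -- `modelDensity` is a Radon–Nikodym derivative, of which `p` is a version
  have hdens : ∀ t ∈ Θ, modelDensity P μ t =ᵐ[μ] p t := fun t ht => by
    have h1 := Measure.rnDeriv_withDensity μ (hp_cont t ht).measurable.ennreal_ofReal
    rw [← hp t ht] at h1
    filter_upwards [h1] with x hx
    rw [modelDensity, hx, ENNReal.toReal_ofReal (hp_nonneg t ht x)]
  have hs : Tendsto (fun t => ∫ x, |s t x * modelDensity P μ t x
      - s θ₀ x * modelDensity P μ θ₀ x| ∂μ) (𝓝[Θ] θ₀) (𝓝 0) := by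
    have h1 := (ENNReal.tendsto_toReal ENNReal.zero_ne_top).comp (hsp_L1 θ₀ hθ₀)
    rw [ENNReal.toReal_zero] at h1
    refine h1.congr' ?_
    filter_upwards [self_mem_nhdsWithin] with t ht
    have hm : AEStronglyMeasurable (fun x => s t x * p t x - s θ₀ x * p θ₀ x) μ :=
      ((hsp_cont t ht).measurable.sub (hsp_cont θ₀ hθ₀).measurable).aestronglyMeasurable
    rw [Function.comp_apply, eLpNorm_one_eq_lintegral_enorm, ← integral_norm_eq_lintegral_enorm hm]
    refine integral_congr_ae ?_
    filter_upwards [hdens t ht, hdens θ₀ hθ₀] with x h2 h3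
    rw [h2, h3, Real.norm_eq_abs]
  refine ⟨fun e he θ hθ => (hDQM θ hθ).exists_isApprox hP α he,
    bddAbove_privateFisherInfos hP (hDQM θ₀ hθ₀) α, ?_⟩
  intro T hT Qhat hQhat θseq hθseq_mem hθseq
  rw [tendstoInMeasure_iff_norm]
  intro δ hδ
  obtain ⟨ρ, hρ, hmain⟩ := exists_abs_discreteFisherInfo_sub_le.{u} hP hDQM hθ₀ hs (hI_cont θ₀ hθ₀)
    α (half_pos hδ)
  refine tendsto_of_tendsto_of_tendsto_of_le_of_le' tendsto_const_nhds
    (tendstoInMeasure_iff_norm.1 hθhat ρ hρ) (.of_forall fun _ => zero_le) ?_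
  filter_upwards [hε.eventually (gt_mem_nhds hρ), Metric.tendsto_nhds.1 hθseq ρ hρ] with n h1 h2
  refine measure_mono fun ω hω => ?_
  by_contra hcon
  have h3 : |θhat n ω - θ₀| < ρ := by simpa [Real.norm_eq_abs] using hcon
  have := hmain (θhat n ω) (hθhat_mem n ω) h3 (θseq n) (hθseq_mem n) h2 (ε n) (hε_pos n) h1
    (T (ε n) (θhat n ω)) (hT _ (hε_pos n) _ (hθhat_mem n ω)) _ (hQhat n ω).1 (hQhat n ω).2
  have h4 : δ ≤ |discreteFisherInfo Θ P (T (ε n) (θhat n ω)) (Qhat n ω) (θseq n)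
      - sSup (privateFisherInfos.{u} α Θ P θ₀)| := hω
  linarith
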